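/- Let $(\xi_t)_{t\ge 0}$ be a real-valued Lévy process (started from $0$, with independent and stationary increments and càdlàg paths) on a probability space $(\Omega,\mathcal A,\mathbb P)$, which drifts to $\infty$, i.e. $\lim_{t\to\infty}\xi_t=\infty$ a.s. Let $(\hat\xi_t)_{t\ge 0}$ be a càdlàg process on the same space which is an independent copy of $(-\xi_t)_{t\ge 0}$, and put $$\tilde\xi_t=\begin{cases}\xi_t, & t\ge 0,\\ \hat\xi_{|t|-}, & t<0,\end{cases}\qquad \hat I=\int_0^\infty e^{\hat\xi_s}\,ds,\qquad \tilde V(t)=e^{-\tilde\xi_t}\int_{-\infty}^t e^{\tilde\xi_s}\,ds\quad(t\in\mathbb R).$$ Almost surely, the integrals $\hat I$ and $\int_{-\infty}^t e^{\tilde\xi_s}\,ds$, $t\in\mathbb R$, are finite, so that $\tilde V(t)\in(0,\infty)$ for all $t\in\mathbb R$. Let $\mu$ be the law of $\hat I$. Then: (i) The process $(\tilde V(t))_{t\in\mathbb R}$ is - stationary: for every $h\in\mathbb R$, $(\tilde V(t+h))_{t\in\mathbb R}$ has the same law as $(\tilde V(t))_{t\in\mathbb R}$; - strongly mixing: for all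 measurable sets $A,B$ of the path space $\mathbb R^{\mathbb R}$ with the product $\sigma$-algebra, $\mathbb P(\tilde V\in A,\ \tilde V(t+\cdot)\in B)\to\mathbb P(\tilde V\in A)\,\mathbb P(\tilde V\in B)$ as $t\to\infty$; - a Feller process: it has a.s. càdlàg paths and is a time-homogeneous Markov process in its own filtration, with the transition semigroup $$P_tf(x)=\mathbb E\Big[f\Big(e^{-\xi_t}\Big(\int_0^t e^{\xi_s}\,ds+x\Big)\Big)\Big],\qquad t\ge0,\ x\in\mathbb R,$$ of the generalized Ornstein–Uhlenbeck process associated with $\xi$, which is a Feller semigroup: it is a semigroup of Markov kernels on $\mathbb R$ (under which $(0,\infty)$ and $[0,\infty)$ are stable), it maps $C_0(\mathbb R)$ into itself, and $P_tf\to f$ uniformly as $t\to0+$ for every $f\in C_0(\mathbb R)$; and its one-dimensional distribution is $\mu$: for every $t\in\mathbb R$, $\tilde V(t)$ has law $\mu$. (ii) For every $f\in L^1(\mu)$, almost surely, $s\mapsto f(\tilde V(s))$ is integrable on every compact interval with endpoint $0$, and $$\lim_{t\to\infty}\frac1t\int_0^t f(\tilde V(s))\,ds=\langle\mu,f\rangle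 .$$ -/

import Mathlib

open MeasureTheory ProbabilityTheory Filter Topology Set
open scoped NNReal ZeroAtInfty

noncomputable section

/-- Right-continuous with left limits at every point of the index set. -/
def IsCadlag {T : Type*} [Preorder T] [TopologicalSpace T] (f : T → ℝ) : Prop :=
  ∀ t, ContinuousWithinAt f (Ici t) t ∧ ∃ l : ℝ, Tendsto f (𝓝[<] t) (𝓝 l)

/-- Real-valued Lévy processes: started from `0`, with independent and stationary increments and
càdlàg paths. -/
structure IsLevyProcess {Ω : Type*} [MeasurableSpace Ω] (ξ : ℝ≥0 → Ω → ℝ) (P : Measure Ω) :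
    Prop where
  measurable : ∀ t, Measurable (ξ t)
  zero : ∀ᵐ ω ∂P, ξ 0 ω = 0
  indep : HasIndepIncrements ξ P
  stationary : ∀ s t, IdentDistrib (fun ω => ξ (s + t) ω - ξ s ω) (ξ t) P P
  cadlag : ∀ ω, IsCadlag (fun t => ξ t ω)

/-- `η` is an independent copy of `-ξ` (as càdlàg processes). -/
structure IsIndepDual {Ω : Type*} [MeasurableSpace Ω] (ξ η : ℝ≥0 → Ω → ℝ) (P : Measure Ω) :
    Prop where
  measurable : ∀ t, Measurable (η t)
  cadlag : ∀ ω, IsCadlag (fun t => η t ω)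
  law : IdentDistrib (fun ω t => η t ω) (fun ω t => -ξ t ω) P P
  indep : IndepFun (fun ω t => ξ t ω) (fun ω t => η t ω) P

variable {Ω : Type*}

/-- The two-sided process: `ξ t` for `t ≥ 0`, and the left limit of `η` at `|t|` for `t < 0`. -/
def twoSided (ξ η : ℝ≥0 → Ω → ℝ) (t : ℝ) (ω : Ω) : ℝ :=
  if 0 ≤ t then ξ t.toNNReal ω else Function.leftLim (fun s => η s ω) (-t).toNNReal

/-- The process `t ↦ e^{-ξ̃_t} ∫_{-∞}^t e^{ξ̃_s} ds`. -/
def twoSidedGOU (ξ η : ℝ≥0 → Ω → ℝ) (t : ℝ) (ω : Ω) : ℝ :=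
  Real.exp (-twoSided ξ η t ω) * ∫ s in Iic t, Real.exp (twoSided ξ η s ω)

/-- The exponential functional `∫_0^∞ e^{η_s} ds`. -/
def expFunctional (η : ℝ≥0 → Ω → ℝ) (ω : Ω) : ℝ :=
  ∫ s in Ioi (0 : ℝ), Real.exp (η s.toNNReal ω)

/-- The generalized Ornstein–Uhlenbeck process `V(t) = e^{-ξ_t} (∫_0^t e^{ξ_s} ds + x)` started
from `V(0) = x`. -/
def gouFrom (ξ : ℝ≥0 → Ω → ℝ) (x : ℝ) (t : ℝ≥0) (ω : Ω) : ℝ :=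
  Real.exp (-ξ t ω) * ((∫ s in (0 : ℝ)..t, Real.exp (ξ s.toNNReal ω)) + x)

/-- A Feller transition semigroup on `E`: a semigroup of Markov kernels that acts on `C₀(E)` and is
strongly continuous there. -/
structure IsFellerSemigroup {E : Type*} [TopologicalSpace E] [MeasurableSpace E]
    (κ : ℝ≥0 → Kernel E E) : Prop where
  markov : ∀ t, IsMarkovKernel (κ t)
  zero : κ 0 = Kernel.id
  add : ∀ s t, κ (s + t) = κ t ∘ₖ κ s
  mapsTo : ∀ (t : ℝ≥0) (f : C₀(E, ℝ)), ∃ g : C₀(E, ℝ), ∀ x, g x = ∫ y, f y ∂(κ t x)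
  strongCont : ∀ f : C₀(E, ℝ),
    TendstoUniformly (fun (t : ℝ≥0) (x : E) => ∫ y, f y ∂(κ t x)) f (𝓝[>] 0)

/-- `X` is a (time-homogeneous) Markov process indexed by `ℝ`, in its own filtration, with
transition kernels `κ`. -/
structure IsMarkovProcess {E : Type*} [mE : MeasurableSpace E] [MeasurableSpace Ω]
    (κ : ℝ≥0 → Kernel E E) (X : ℝ → Ω → E) (P : Measure Ω) : Prop where
  measurable : ∀ t, Measurable (X t)
  markov : ∀ (s : ℝ) (t : ℝ≥0) (B : Set E), MeasurableSet B →
    P⟦X (s + t) ⁻¹' B | ⨆ u : Iic s, MeasurableSpace.comap (X u) mE⟧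
      =ᵐ[P] fun ω => (κ t (X s ω)).real B

/-- `X` is a real-valued Feller process with transition semigroup `κ`, with time set `ℝ`. -/
structure IsFellerProcess [MeasurableSpace Ω]
    (κ : ℝ≥0 → Kernel ℝ ℝ) (X : ℝ → Ω → ℝ) (P : Measure Ω) : Prop where
  semigroup : IsFellerSemigroup κ
  markov : IsMarkovProcess κ X P
  cadlag : ∀ᵐ ω ∂P, IsCadlag (fun t => X t ω)

/-- The law of the whole path is invariant under time shifts. -/
def IsStationaryProcess [MeasurableSpace Ω] (X : ℝ → Ω → ℝ) (P : Measure Ω) : Prop :=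
  ∀ h : ℝ, IdentDistrib (fun ω t => X (t + h) ω) (fun ω t => X t ω) P P

/-- Strong mixing of the flow of time shifts under the law of the path of `X`:
`P(X ∈ A, X(t + ·) ∈ B) → P(X ∈ A) P(X ∈ B)` for all measurable sets of paths `A`, `B`. -/
def IsStronglyMixing [MeasurableSpace Ω] (X : ℝ → Ω → ℝ) (P : Measure Ω) : Prop :=
  ∀ A B : Set (ℝ → ℝ), MeasurableSet A → MeasurableSet B →
    Tendsto (fun t : ℝ => P {ω | (fun s => X s ω) ∈ A ∧ (fun s => X (t + s) ω) ∈ B}) atTop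
      (𝓝 (P {ω | (fun s => X s ω) ∈ A} * P {ω | (fun s => X s ω) ∈ B}))

end

/-! Everything is a functional of the two-sided Lévy path Y. Let θ_h send a path w to its increments
after time h, s ↦ w(h + s) - w(h) (`shiftIncr`). Stationary increments mean that θ_h preserves the
law of Y; independent increments mean that the past and the future of θ_h Y are independent.
Cylinder events far apart in time are then exactly independent, and cylinders are dense in measure,
so the flow θ is strongly mixing (`IsTwoSidedLevy.tendsto_measureReal`) and each θ_h with h > 0 is
ergodic.

The functional Φ(w)(t) = e^{-w(t)} ∫_{-∞}^t e^{w} (`gouPath`) is unchanged when a constant is added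
to w, hence Φ(θ_h w) = Φ(w)(h + ·). So the process Φ(Y) is a factor of θ, and inherits stationarity
and mixing. Its marginal can be read off at time 0, where time reversal turns the integral into the
exponential functional of the dual.

Splitting the integral at time s shows that Φ(Y)(s + t) is an affine function of Φ(Y)(s), with
coefficients that depend only on the increments after s (`IsCadlag.gouPath_add`). These are
independent of the past, which gives the Markov property; the same cocycle identity gives the
semigroup. The Feller properties follow by dominated convergence, the flow being affine in x with
positive slope.

Finiteness of the integrals needs an argument, as ξ need not have a mean. For h large, the event
that the path stays one unit above its starting value after time h has positive probability, because
of the drift. By Birkhoff's theorem it recurs with positive frequency along the multiples of h, and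
each occurrence raises the path by a unit: the growth is at least linear. Part (ii) is Birkhoff's
theorem again, for the integral of f(Φ(Y)) over a unit of time. -/

/-! ### Birkhoff's ergodic theorem, through the maximal ergodic theorem. -/

section Birkhoff

variable {α : Type*} {T : α → α} {g : α → ℝ}

/-- The maximum of the Birkhoff sums of orders `0, …, N`. -/
noncomputable def birkhoffMax (T : α → α) (g : α → ℝ) : ℕ → α → ℝ
  | 0 => 0
  | N + 1 => birkhoffMax T g N ⊔ birkhoffSum T g (N + 1)

lemma birkhoffSum_le_birkhoffMax {n N : ℕ} (h : n ≤ N) (x : α) :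
    birkhoffSum T g n x ≤ birkhoffMax T g N x := by
  induction N with
  | zero => obtain rfl : n = 0 := by omega
            simp [birkhoffMax]
  | succ N ih =>
    rcases Nat.lt_or_ge n (N + 1) with h' | h'
    · exact (ih (by omega)).trans le_sup_left
    · obtain rfl : n = N + 1 := by omega
      exact le_sup_right

lemma birkhoffMax_le {N : ℕ} {x : α} {c : ℝ} (h : ∀ n ≤ N, birkhoffSum T g n x ≤ c) :
    birkhoffMax T g N x ≤ c := by
  induction N with
  | zero => simpa [birkhoffMax] using h 0 le_rfl
  | succ N ih => exact sup_le (ih fun n hn => h n (by omega)) (h _ le_rfl)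

lemma birkhoffMax_nonneg (N : ℕ) (x : α) : 0 ≤ birkhoffMax T g N x := by
  simpa using birkhoffSum_le_birkhoffMax (T := T) (g := g) (Nat.zero_le N) x

/-- Every sum of order n + 1 at x is `g x` plus the sum of order n at `T x`. Only the empty sum
escapes this, and positivity of the maximum excludes it. -/
lemma birkhoffMax_le_add {N : ℕ} {x : α} (h : 0 < birkhoffMax T g N x) :
    birkhoffMax T g N x ≤ g x + birkhoffMax T g N (T x) := by
  by_contra! hlt
  have hle : birkhoffMax T g N x ≤ max 0 (g x + birkhoffMax T g N (T x)) := by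
    refine birkhoffMax_le fun n hn => ?_
    rcases n with _ | n
    · simp
    · rw [birkhoffSum_succ']
      exact le_max_of_le_right
        (by gcongr; exact birkhoffSum_le_birkhoffMax (by omega) _)
  rcases le_max_iff.1 hle with h0 | h0 <;> linarith

variable [MeasurableSpace α] {μ : Measure α}

lemma MeasureTheory.MeasurePreserving.integrable_birkhoffSum (hT : MeasurePreserving T μ μ)
    (hg : Integrable g μ) (n : ℕ) : Integrable (birkhoffSum T g n) μ := by
  unfold birkhoffSum
  exact integrable_finsetSum _ fun k _ => (hT.iterate k).integrable_comp_of_integrable hg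

lemma measurable_birkhoffSum (hT : Measurable T) (hg : Measurable g) (n : ℕ) :
    Measurable (birkhoffSum T g n) := by
  unfold birkhoffSum
  exact Finset.measurable_sum _ fun k _ => hg.comp (hT.iterate k)

lemma measurable_birkhoffMax (hT : Measurable T) (hg : Measurable g) (N : ℕ) :
    Measurable (birkhoffMax T g N) := by
  induction N with
  | zero => exact measurable_const
  | succ N ih => exact ih.sup (measurable_birkhoffSum hT hg _)

lemma MeasureTheory.MeasurePreserving.integrable_birkhoffMax (hT : MeasurePreserving T μ μ)
    (hg : Integrable g μ) (N : ℕ) : Integrable (birkhoffMax T g N) μ := by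
  induction N with
  | zero => exact integrable_zero _ _ _
  | succ N ih => exact ih.sup (hT.integrable_birkhoffSum hg _)

/-- The maximal ergodic theorem. -/
lemma MeasureTheory.MeasurePreserving.setIntegral_birkhoffMax_pos_nonneg
    (hT : MeasurePreserving T μ μ) (hgm : Measurable g) (hg : Integrable g μ) (N : ℕ) :
    0 ≤ ∫ x in {x | 0 < birkhoffMax T g N x}, g x ∂μ := by
  set M := birkhoffMax T g N with hM
  have hMi : Integrable M μ := hT.integrable_birkhoffMax hg N
  have hMT : Integrable (fun x => M (T x)) μ := hT.integrable_comp_of_integrable hMi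
  have hms : MeasurableSet {x | 0 < M x} :=
    measurableSet_lt measurable_const (measurable_birkhoffMax hT.measurable hgm N)
  -- Garsia's argument: `g` dominates `M - M ∘ T` on `{M > 0}`; the latter has total integral 0 and
  -- is nonpositive off that set, where `M = 0`.
  have h1 : ∫ x in {x | 0 < M x}, (M x - M (T x)) ∂μ ≤ ∫ x in {x | 0 < M x}, g x ∂μ := by
    refine setIntegral_mono_on (hMi.sub hMT).integrableOn hg.integrableOn hms fun x hx => ?_
    have := birkhoffMax_le_add (T := T) (g := g) (N := N) hx
    linarith
  have h2 : ∫ x, (M x - M (T x)) ∂μ = 0 := by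
    rw [integral_sub hMi hMT, sub_eq_zero]
    conv_lhs => rw [← hT.map_eq]
    refine integral_map hT.measurable.aemeasurable ?_
    rw [hT.map_eq]
    exact hMi.aestronglyMeasurable
  have h3 : ∫ x, (M x - M (T x)) ∂μ ≤ ∫ x in {x | 0 < M x}, (M x - M (T x)) ∂μ := by
    rw [← integral_indicator hms]
    refine integral_mono (hMi.sub hMT) ((hMi.sub hMT).indicator hms) fun x => ?_
    by_cases hx : 0 < M x
    · rw [indicator_of_mem (by exact hx)]
    · rw [indicator_of_notMem (by exact hx)]
      have := birkhoffMax_nonneg (T := T) (g := g) N (T x)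
      simp only [not_lt] at hx
      linarith
  linarith

/-- If `∫ g < 0` then the Birkhoff sums of `g` are bounded above almost everywhere. -/
lemma Ergodic.ae_bddAbove_birkhoffSum [IsProbabilityMeasure μ] (hT : Ergodic T μ)
    (hgm : Measurable g) (hg : Integrable g μ) (hneg : ∫ x, g x ∂μ < 0) :
    ∀ᵐ x ∂μ, ∃ K : ℝ, ∀ n, birkhoffSum T g n x ≤ K := by
  set A : Set α := {x | ∃ K : ℕ, ∀ n, birkhoffSum T g n x ≤ K} with hA
  have hAm : MeasurableSet A := by
    rw [hA]
    simp only [ofPred_exists, ofPred_forall]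
    exact MeasurableSet.iUnion fun K => MeasurableSet.iInter fun n =>
      measurableSet_le (measurable_birkhoffSum hT.measurable hgm n) measurable_const
  have hinv : T ⁻¹' A = A := by
    ext x
    simp only [hA, mem_preimage, mem_ofPred_eq]
    constructor
    · rintro ⟨K, hK⟩
      obtain ⟨L, hL⟩ := exists_nat_ge (max 0 (g x + K))
      refine ⟨L, fun n => ?_⟩
      rcases n with _ | n
      · simp
      · rw [birkhoffSum_succ']
        exact le_trans (by gcongr; exact hK n) ((le_max_right _ _).trans hL)
    · rintro ⟨K, hK⟩
      obtain ⟨L, hL⟩ := exists_nat_ge (K - g x)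
      refine ⟨L, fun n => ?_⟩
      have := hK (n + 1)
      rw [birkhoffSum_succ'] at this
      linarith
  -- If the invariant set `A` is null, the sets `{birkhoffMax > 0}` increase to the whole space up
  -- to a null set, and the maximal inequality yields `∫ g ≥ 0` in the limit.
  rcases hT.ae_mem_or_ae_notMem hAm hinv with h | h
  · filter_upwards [h] with x ⟨K, hK⟩ using ⟨K, hK⟩
  · exfalso
    have hlim : Tendsto (fun N => ∫ x in {x | 0 < birkhoffMax T g N x}, g x ∂μ) atTop
        (𝓝 (∫ x, g x ∂μ)) := by
      have hms : ∀ N, MeasurableSet {x | 0 < birkhoffMax T g N x} := fun N =>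
        measurableSet_lt measurable_const (measurable_birkhoffMax hT.measurable hgm N)
      simp_rw [← integral_indicator (hms _)]
      refine tendsto_integral_of_dominated_convergence (fun x => |g x|)
        (fun N => (hg.aestronglyMeasurable.indicator (hms N))) hg.abs
        (fun N => Eventually.of_forall fun x => ?_) ?_
      · rw [Real.norm_eq_abs]
        exact (norm_indicator_le_norm_self (f := g) x)
      · filter_upwards [h] with x hx
        simp only [hA, mem_ofPred_eq, not_exists, not_forall, not_le] at hx
        obtain ⟨n, hn⟩ := hx 0
        refine tendsto_const_nhds.congr' ?_
        filter_upwards [eventually_ge_atTop n] with N hN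
        rw [indicator_of_mem]
        have := birkhoffSum_le_birkhoffMax (T := T) (g := g) hN x
        simp only [mem_ofPred_eq]
        simp only [Nat.cast_zero] at hn
        linarith
    exact absurd (ge_of_tendsto' hlim fun N =>
      hT.toMeasurePreserving.setIntegral_birkhoffMax_pos_nonneg hgm hg N) (by linarith)

lemma Ergodic.ae_eventually_birkhoffSum_lt [IsProbabilityMeasure μ] (hT : Ergodic T μ)
    (hgm : Measurable g) (hg : Integrable g μ) {c : ℝ} (hc : ∫ x, g x ∂μ < c) :
    ∀ᵐ x ∂μ, ∀ᶠ n : ℕ in atTop, birkhoffSum T g n x < n * c := by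
  obtain ⟨d, hd, hdc⟩ := exists_between hc
  have := hT.ae_bddAbove_birkhoffSum (g := fun x => g x - d) (hgm.sub_const _)
    (hg.sub (integrable_const _)) (by
      rw [integral_sub hg (integrable_const _)]
      simpa using hd)
  filter_upwards [this] with x ⟨K, hK⟩
  obtain ⟨m, hm⟩ := exists_nat_gt (K / (c - d))
  filter_upwards [eventually_ge_atTop m] with n hn
  have h1 := hK n
  have h2 : birkhoffSum T (fun x => g x - d) n x = birkhoffSum T g n x - n * d := by
    simp [birkhoffSum, Finset.sum_sub_distrib]
  have h3 : K / (c - d) < n := hm.trans_le (by exact_mod_cast hn)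
  rw [div_lt_iff₀ (by linarith)] at h3
  linarith

/-- Birkhoff's pointwise ergodic theorem. -/
theorem Ergodic.ae_tendsto_birkhoffAverage [IsProbabilityMeasure μ] (hT : Ergodic T μ)
    (hgm : Measurable g) (hg : Integrable g μ) :
    ∀ᵐ x ∂μ, Tendsto (fun n => birkhoffAverage ℝ T g n x) atTop (𝓝 (∫ x, g x ∂μ)) := by
  have h1 : ∀ᵐ x ∂μ, ∀ k : ℕ, ∀ᶠ n : ℕ in atTop,
      birkhoffSum T g n x < n * (∫ x, g x ∂μ + 1 / (k + 1)) :=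
    ae_all_iff.2 fun k => hT.ae_eventually_birkhoffSum_lt hgm hg
      (lt_add_of_pos_right _ (by positivity))
  -- The upper bound for `-g` is the lower bound for `g`.
  have h2 : ∀ᵐ x ∂μ, ∀ k : ℕ, ∀ᶠ n : ℕ in atTop,
      birkhoffSum T (fun x => -g x) n x < n * (∫ x, -g x ∂μ + 1 / (k + 1)) :=
    ae_all_iff.2 fun k => hT.ae_eventually_birkhoffSum_lt hgm.neg hg.neg
      (lt_add_of_pos_right _ (by positivity))
  filter_upwards [h1, h2] with x h1 h2
  rw [Metric.tendsto_nhds]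
  intro ε hε
  obtain ⟨k, hk⟩ := exists_nat_one_div_lt hε
  filter_upwards [h1 k, h2 k, eventually_gt_atTop 0] with n h1 h2 hn
  have hn' : (0 : ℝ) < n := by exact_mod_cast hn
  have h3 : birkhoffSum T (fun x => -g x) n x = -birkhoffSum T g n x := by simp [birkhoffSum]
  rw [h3, integral_neg] at h2
  rw [birkhoffAverage, smul_eq_mul, Real.dist_eq, inv_mul_eq_div, abs_lt]
  constructor
  · rw [lt_sub_iff_add_lt, lt_div_iff₀ hn']
    nlinarith
  · rw [sub_lt_iff_lt_add, div_lt_iff₀ hn']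
    nlinarith

end Birkhoff

/-! ### Càdlàg functions: operations, time reversal, pasting at 0. -/

section Cadlag

lemma IsCadlag.comp_continuous {T : Type*} [Preorder T] [TopologicalSpace T] {f : T → ℝ}
    (hf : IsCadlag f) {g : ℝ → ℝ} (hg : Continuous g) : IsCadlag fun t => g (f t) := fun t =>
  ⟨hg.continuousAt.comp_continuousWithinAt (hf t).1,
    (hf t).2.imp' g fun l hl => (hg.tendsto l).comp hl⟩

lemma IsCadlag.mul {T : Type*} [Preorder T] [TopologicalSpace T] {f g : T → ℝ}
    (hf : IsCadlag f) (hg : IsCadlag g) : IsCadlag fun t => f t * g t := fun t => by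
  obtain ⟨l, hl⟩ := (hf t).2
  obtain ⟨m, hm⟩ := (hg t).2
  exact ⟨(hf t).1.mul (hg t).1, l * m, hl.mul hm⟩

lemma Continuous.isCadlag {T : Type*} [Preorder T] [TopologicalSpace T] {f : T → ℝ}
    (hf : Continuous f) : IsCadlag f := fun t =>
  ⟨hf.continuousWithinAt, f t, (hf.tendsto t).mono_left nhdsWithin_le_nhds⟩

lemma IsCadlag.comp_toNNReal {f : ℝ≥0 → ℝ} (hf : IsCadlag f) :
    IsCadlag fun t : ℝ => f t.toNNReal := by
  intro t
  refine ⟨(hf t.toNNReal).1.comp continuous_real_toNNReal.continuousWithinAt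
    fun s hs => Real.toNNReal_mono hs, ?_⟩
  rcases le_or_gt t 0 with ht | ht
  · refine ⟨f 0, tendsto_const_nhds.congr' ?_⟩
    filter_upwards [self_mem_nhdsWithin] with s hs
    rw [Real.toNNReal_of_nonpos ((le_of_lt hs).trans ht)]
  · obtain ⟨l, hl⟩ := (hf t.toNNReal).2
    refine ⟨l, hl.comp (tendsto_nhdsWithin_iff.2 ⟨?_, ?_⟩)⟩
    · exact continuous_real_toNNReal.continuousAt.tendsto.mono_left nhdsWithin_le_nhds
    · filter_upwards [self_mem_nhdsWithin] with s hs
      exact (Real.toNNReal_lt_toNNReal_iff ht).2 hs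

lemma leftLim_toNNReal {f : ℝ≥0 → ℝ} (hf : IsCadlag f) {t : ℝ} (ht : 0 < t) :
    Function.leftLim f t.toNNReal = Function.leftLim (fun s : ℝ => f s.toNNReal) t := by
  symm
  refine leftLim_eq_of_tendsto
    ((tendsto_leftLim_of_tendsto (hf t.toNNReal).2).comp (tendsto_nhdsWithin_iff.2 ⟨?_, ?_⟩))
  · exact continuous_real_toNNReal.continuousAt.tendsto.mono_left nhdsWithin_le_nhds
  · filter_upwards [self_mem_nhdsWithin] with s hs
    exact (Real.toNNReal_lt_toNNReal_iff ht).2 hs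

lemma IsCadlag.tendsto_leftLim {f : ℝ → ℝ} (hf : IsCadlag f) (t : ℝ) :
    Tendsto f (𝓝[<] t) (𝓝 (Function.leftLim f t)) :=
  tendsto_leftLim_of_tendsto (hf t).2

/-- The left limit at a point c slightly to the right of t is a limit of values on (t, c), which lie
in a given closed neighbourhood of `f t`. After reversal of time this provides the left limits. -/
lemma IsCadlag.tendsto_leftLim_nhdsGT {f : ℝ → ℝ} (hf : IsCadlag f) (t : ℝ) :
    Tendsto (Function.leftLim f) (𝓝[>] t) (𝓝 (f t)) := by
  apply (closed_nhds_basis (f t)).tendsto_right_iff.2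
  rintro s ⟨s_mem, s_closed⟩
  have h1 : Tendsto f (𝓝[>] t) (𝓝 (f t)) := (hf t).1.mono_left (nhdsWithin_mono _ Ioi_subset_Ici_self)
  obtain ⟨u, au, hu⟩ := mem_nhdsGT_iff_exists_Ioo_subset.1 (h1 s_mem)
  filter_upwards [Ioo_mem_nhdsGT au] with c hc
  apply s_closed.mem_of_tendsto (hf.tendsto_leftLim c)
  filter_upwards [Ioo_mem_nhdsLT hc.1] with d hd using hu ⟨hd.1, hd.2.trans hc.2⟩

/-- The time reversal of a càdlàg function, made right-continuous, is càdlàg. -/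
lemma IsCadlag.leftLim_neg {f : ℝ → ℝ} (hf : IsCadlag f) :
    IsCadlag fun t => Function.leftLim f (-t) := by
  intro t
  refine ⟨?_, f (-t), (hf.tendsto_leftLim_nhdsGT (-t)).comp tendsto_neg_nhdsLT⟩
  refine (continuousWithinAt_leftLim_Iic (hf.tendsto_leftLim (-t))).comp
    continuous_neg.continuousWithinAt fun s hs => ?_
  simpa using hs

lemma IsCadlag.ite_nonneg {f g : ℝ → ℝ} (hf : IsCadlag f) (hg : IsCadlag g) :
    IsCadlag fun t => if 0 ≤ t then f t else g t := by
  intro t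
  rcases lt_or_ge t 0 with ht | ht
  · have h : (fun t => if 0 ≤ t then f t else g t) =ᶠ[𝓝 t] g := by
      filter_upwards [Iio_mem_nhds ht] with s hs
      exact if_neg (not_le.2 hs)
    refine ⟨(hg t).1.congr_of_eventuallyEq (h.filter_mono nhdsWithin_le_nhds) h.eq_of_nhds, ?_⟩
    obtain ⟨l, hl⟩ := (hg t).2
    exact ⟨l, hl.congr' (h.symm.filter_mono nhdsWithin_le_nhds)⟩
  · refine ⟨(hf t).1.congr (fun s hs => if_pos (ht.trans hs)) (if_pos ht), ?_⟩
    rcases ht.eq_or_lt with rfl | ht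
    · obtain ⟨l, hl⟩ := (hg 0).2
      refine ⟨l, hl.congr' ?_⟩
      filter_upwards [self_mem_nhdsWithin] with s hs
      exact (if_neg (not_le.2 hs)).symm
    · obtain ⟨l, hl⟩ := (hf t).2
      refine ⟨l, hl.congr' ?_⟩
      filter_upwards [mem_nhdsWithin_of_mem_nhds (Ioi_mem_nhds ht)] with s hs
      exact (if_pos (le_of_lt hs)).symm

lemma twoSided_of_nonneg (ξ η : ℝ≥0 → Ω → ℝ) {t : ℝ} (ht : 0 ≤ t) (ω : Ω) :
    twoSided ξ η t ω = ξ t.toNNReal ω := if_pos ht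

lemma twoSided_eq {ξ η : ℝ≥0 → Ω → ℝ} {ω : Ω} (hη : IsCadlag fun t => η t ω) (t : ℝ) :
    twoSided ξ η t ω = if 0 ≤ t then ξ t.toNNReal ω
      else Function.leftLim (fun s : ℝ => η s.toNNReal ω) (-t) := by
  unfold twoSided
  split_ifs with h
  · rfl
  · rw [leftLim_toNNReal hη (by linarith)]

lemma isCadlag_twoSided {ξ η : ℝ≥0 → Ω → ℝ} {ω : Ω} (hξ : IsCadlag fun t => ξ t ω)
    (hη : IsCadlag fun t => η t ω) : IsCadlag fun t => twoSided ξ η t ω := by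
  simp_rw [twoSided_eq hη]
  exact hξ.comp_toNNReal.ite_nonneg hη.comp_toNNReal.leftLim_neg

end Cadlag

/-! ### Joint measurability in path and time. -/

section Sampling

/-- Right-continuity at every point. -/
def IsRightCts (w : ℝ → ℝ) : Prop := ∀ t, ContinuousWithinAt w (Ici t) t

lemma IsCadlag.isRightCts {w : ℝ → ℝ} (hw : IsCadlag w) : IsRightCts w := fun t => (hw t).1

/-- The first point of the grid of mesh `1 / (n + 1)` that is larger than `s`. -/
noncomputable def gridTime (n : ℕ) (s : ℝ) : ℝ := ((⌊(n + 1) * s⌋ : ℤ) + 1) / (n + 1)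

lemma lt_gridTime (n : ℕ) (s : ℝ) : s < gridTime n s := by
  rw [gridTime, lt_div_iff₀ (by positivity), mul_comm]
  exact Int.lt_floor_add_one _

lemma gridTime_le (n : ℕ) (s : ℝ) : gridTime n s ≤ s + 1 / (n + 1) := by
  have h : (0 : ℝ) < n + 1 := by positivity
  rw [gridTime, div_le_iff₀ h, add_mul s, one_div_mul_cancel h.ne', mul_comm s]
  gcongr
  exact Int.floor_le _

lemma tendsto_gridTime (s : ℝ) : Tendsto (fun n => gridTime n s) atTop (𝓝[≥] s) := by
  refine tendsto_nhdsWithin_iff.2 ⟨?_, Eventually.of_forall fun n => (lt_gridTime n s).le⟩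
  refine tendsto_of_tendsto_of_tendsto_of_le_of_le tendsto_const_nhds ?_
    (fun n => (lt_gridTime n s).le) fun n => gridTime_le n s
  simpa using tendsto_const_nhds.add (tendsto_one_div_add_atTop_nhds_zero_nat (𝕜 := ℝ))

/-- A version of the path `w` that is measurable in `(w, s)` for the product `σ`-algebra on the
paths. It is `w` itself if `w` is right-continuous. -/
noncomputable def regPath (w : ℝ → ℝ) (s : ℝ) : ℝ := liminf (fun n => w (gridTime n s)) atTop

lemma IsRightCts.regPath_eq {w : ℝ → ℝ} (hw : IsRightCts w) : regPath w = w :=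
  funext fun s => ((hw s).tendsto.comp (tendsto_gridTime s)).liminf_eq

/-- Evaluation at a grid time depends on s only through an integer, so measurability may be checked
for one integer at a time. -/
lemma measurable_regPath : Measurable fun p : (ℝ → ℝ) × ℝ => regPath p.1 p.2 := by
  refine Measurable.liminf fun n => ?_
  have h1 : Measurable fun p : (ℝ → ℝ) × ℤ => p.1 ((p.2 + 1) / (n + 1)) :=
    by
    refine measurable_from_prod_countable_left fun k => ?_
    exact measurable_pi_apply (X := fun _ : ℝ => ℝ) (((k : ℝ) + 1) / (n + 1))
  have h2 : Measurable fun p : (ℝ → ℝ) × ℝ => (p.1, ⌊(n + 1) * p.2⌋) :=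
    measurable_fst.prodMk (Int.measurable_floor.comp (by fun_prop))
  exact h1.comp h2

lemma Measurable.regPath {β : Type*} [MeasurableSpace β] {f : β → ℝ → ℝ} {g : β → ℝ}
    (hf : Measurable f) (hg : Measurable g) : Measurable fun b => regPath (f b) (g b) :=
  measurable_regPath.comp (hf.prodMk hg)

lemma IsRightCts.measurable {w : ℝ → ℝ} (hw : IsRightCts w) : Measurable w := by
  rw [← hw.regPath_eq]
  exact measurable_const.regPath measurable_id

lemma IsCadlag.locallyIntegrable {w : ℝ → ℝ} (hw : IsCadlag w) : LocallyIntegrable w volume := by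
  intro t
  obtain ⟨l, hl⟩ := (hw t).2
  have hm := hw.isRightCts.measurable.stronglyMeasurable
  rw [← nhdsLT_sup_nhdsGE, IntegrableAtFilter.sup_iff]
  exact ⟨(volume.finiteAt_nhdsWithin t _).integrableAtFilter_of_tendsto
      hm.stronglyMeasurableAtFilter hl,
    (volume.finiteAt_nhdsWithin t _).integrableAtFilter_of_tendsto
      hm.stronglyMeasurableAtFilter (hw t).1⟩

lemma IsCadlag.intervalIntegrable_exp {w : ℝ → ℝ} (hw : IsCadlag w) (a b : ℝ) :
    IntervalIntegrable (fun s => Real.exp (w s)) volume a b := by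
  rw [intervalIntegrable_iff]
  exact ((hw.comp_continuous Real.continuous_exp).locallyIntegrable.integrableOn_isCompact
    isCompact_uIcc).mono_set uIoc_subset_uIcc

/-- The stationary generalized Ornstein–Uhlenbeck path driven by the path `w`. -/
noncomputable def gouPath (w : ℝ → ℝ) (t : ℝ) : ℝ :=
  Real.exp (-regPath w t) * ∫ s in Iic t, Real.exp (regPath w s)

/-- The generalized Ornstein–Uhlenbeck path driven by the path `w` that starts at `x`. -/
noncomputable def gouFlow (x t : ℝ) (w : ℝ → ℝ) : ℝ :=
  Real.exp (-regPath w t) * ((∫ s in (0 : ℝ)..t, Real.exp (regPath w s)) + x)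

lemma measurable_gouPath : Measurable fun p : (ℝ → ℝ) × ℝ => gouPath p.1 p.2 := by
  unfold gouPath
  refine (Measurable.regPath measurable_fst measurable_snd).neg.exp.mul ?_
  have h0 : Measurable fun q : ((ℝ → ℝ) × ℝ) × ℝ => Real.exp (regPath q.1.1 q.2) :=
    (Measurable.regPath measurable_fst.fst measurable_snd).exp
  -- The moving domain `Iic t` is replaced by a jointly measurable indicator.
  have hs : MeasurableSet {r : ((ℝ → ℝ) × ℝ) × ℝ | r.2 ≤ r.1.2} :=
    measurableSet_le measurable_snd measurable_fst.snd
  have h2 := ((h0.indicator hs).stronglyMeasurable.integral_prod_right' (ν := volume)).measurable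
  convert! h2 using 2 with p
  rw [← integral_indicator measurableSet_Iic]
  rfl

lemma measurable_gouPath_apply (t : ℝ) : Measurable fun w : ℝ → ℝ => gouPath w t := by
  have h : Measurable fun w : ℝ → ℝ => (w, t) := measurable_id.prodMk measurable_const
  have h2 := measurable_gouPath.comp h
  exact h2

lemma measurable_gouPath_pi : Measurable gouPath := measurable_pi_lambda _ measurable_gouPath_apply

lemma measurable_setIntegral_exp_regPath (S : Set ℝ) :
    Measurable fun w : ℝ → ℝ => ∫ s in S, Real.exp (regPath w s) := by
  have h : Measurable fun q : (ℝ → ℝ) × ℝ => Real.exp (regPath q.1 q.2) :=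
    (Measurable.regPath measurable_fst measurable_snd).exp
  have h2 := h.stronglyMeasurable.integral_prod_right' (ν := volume.restrict S)
  exact h2.measurable

lemma measurable_gouFlow (t : ℝ) : Measurable fun p : ℝ × (ℝ → ℝ) => gouFlow p.1 t p.2 := by
  have h1 : Measurable fun w : ℝ → ℝ => Real.exp (-regPath w t) :=
    (Measurable.regPath measurable_id measurable_const).neg.exp
  have h2 : Measurable fun w : ℝ → ℝ => ∫ s in (0 : ℝ)..t, Real.exp (regPath w s) :=
    (measurable_setIntegral_exp_regPath (Ioc 0 t)).sub (measurable_setIntegral_exp_regPath (Ioc t 0))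
  exact (h1.comp measurable_snd).mul ((h2.comp measurable_snd).add measurable_fst)

lemma IsRightCts.gouPath_eq {w : ℝ → ℝ} (hw : IsRightCts w) (t : ℝ) :
    gouPath w t = Real.exp (-w t) * ∫ s in Iic t, Real.exp (w s) := by
  rw [gouPath, hw.regPath_eq]

lemma IsRightCts.gouFlow_eq {w : ℝ → ℝ} (hw : IsRightCts w) (x t : ℝ) :
    gouFlow x t w = Real.exp (-w t) * ((∫ s in (0 : ℝ)..t, Real.exp (w s)) + x) := by
  rw [gouFlow, hw.regPath_eq]

end Sampling

/-! ### Two-sided Lévy processes: stationarity as processes from laws of single increments. -/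

section TwoSided

lemma exists_iInter_preimage_eq_preimage {ι δ : Type*} [MeasurableSpace δ] {D : ι → Ω → ℝ}
    {W : Ω → δ} {S : Finset ι} {B : ι → Set ℝ} (hB : ∀ i ∈ S, MeasurableSet (B i))
    (hW : ∀ i ∈ S, ∃ g : δ → ℝ, Measurable g ∧ D i = g ∘ W) :
    ∃ A : Set δ, MeasurableSet A ∧ ⋂ i ∈ S, D i ⁻¹' B i = W ⁻¹' A := by
  choose! g hg using hW
  refine ⟨⋂ i ∈ S, g i ⁻¹' B i, ?_, ?_⟩
  · exact Finset.measurableSet_biInter _ fun i hi => (hg i hi).1 (hB i hi)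
  · rw [preimage_iInter₂]
    refine iInter₂_congr fun i hi => ?_
    rw [(hg i hi).2, preimage_comp]

/-- Two families that are functions of independent variables combine to an independent family. -/
lemma iIndepFun_of_indepFun_of_split {ι α β : Type*} [MeasurableSpace Ω] [MeasurableSpace α]
    [MeasurableSpace β] {P : Measure Ω} {D : ι → Ω → ℝ} (p : ι → Prop)
    {U : Ω → α} {V : Ω → β} (hUV : IndepFun U V P)
    (hU : ∀ i, p i → ∃ g : α → ℝ, Measurable g ∧ D i = g ∘ U)
    (hV : ∀ i, ¬ p i → ∃ g : β → ℝ, Measurable g ∧ D i = g ∘ V)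
    (h1 : iIndepFun (fun i : {i // p i} => D i) P)
    (h2 : iIndepFun (fun i : {i // ¬ p i} => D i) P) : iIndepFun D P := by
  classical
  rw [iIndepFun_iff_measure_inter_preimage_eq_mul]
  intro S B hB
  have key : ∀ (q : ι → Prop) [DecidablePred q] (_ : iIndepFun (fun i : {i // q i} => D i) P),
      P (⋂ i ∈ S.filter q, D i ⁻¹' B i) = ∏ i ∈ S.filter q, P (D i ⁻¹' B i) := by
    intro q _ hq
    have h := hq.measure_inter_preimage_eq_mul (S.subtype q) (sets := fun i => B i)
      fun i hi => hB i (Finset.mem_subtype.1 hi)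
    rw [Finset.prod_subtype_eq_prod_filter (fun i => P (D i ⁻¹' B i))] at h
    rw [← h]
    congr 1
    ext ω
    simp only [mem_iInter, Finset.mem_filter, Finset.mem_subtype, mem_preimage, Subtype.forall]
    exact ⟨fun h a b c => h a ⟨c, b⟩, fun h a b => h a b.2 b.1⟩
  obtain ⟨A, hA, hA'⟩ := exists_iInter_preimage_eq_preimage (S := S.filter p)
    (fun i hi => hB i (Finset.mem_filter.1 hi).1) fun i hi => hU i (Finset.mem_filter.1 hi).2
  obtain ⟨A', hAm', hA''⟩ := exists_iInter_preimage_eq_preimage (S := S.filter fun i => ¬ p i)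
    (fun i hi => hB i (Finset.mem_filter.1 hi).1) fun i hi => hV i (Finset.mem_filter.1 hi).2
  have hsplit : ⋂ i ∈ S, D i ⁻¹' B i =
      (⋂ i ∈ S.filter p, D i ⁻¹' B i) ∩ ⋂ i ∈ S.filter (fun i => ¬ p i), D i ⁻¹' B i := by
    ext ω
    simp only [mem_inter_iff, mem_iInter, Finset.mem_filter]
    exact ⟨fun h => ⟨fun i hi => h i hi.1, fun i hi => h i hi.1⟩,
      fun h i hi => by
        by_cases hp : p i
        · exact h.1 i ⟨hi, hp⟩
        · exact h.2 i ⟨hi, hp⟩⟩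
  rw [hsplit, hA', hA'', hUV.measure_inter_preimage_eq_mul _ _ hA hAm', ← hA', ← hA'', key p h1,
    key _ h2, Finset.prod_filter_mul_prod_filter_not]

/-- List the points in increasing order and repeat the largest one forever. -/
lemma Finset.exists_monotone_nat_cover {K : Finset ℝ} (hK : K.Nonempty) :
    ∃ t : ℕ → ℝ, Monotone t ∧ ∀ x ∈ K, ∃ i, t i = x := by
  have hpos : 0 < K.card := hK.card_pos
  refine ⟨fun i => K.orderEmbOfFin rfl ⟨min i (K.card - 1), by omega⟩, fun i j hij => ?_,
    fun x hx => ?_⟩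
  · refine (K.orderEmbOfFin rfl).monotone ?_
    simp only [Fin.mk_le_mk]
    omega
  · have : x ∈ Set.range (K.orderEmbOfFin rfl) := by simpa using hx
    obtain ⟨i, hi⟩ := this
    refine ⟨i, ?_⟩
    rw [← hi]
    change K.orderEmbOfFin rfl _ = _
    congr 1
    exact Fin.ext (min_eq_left (by omega))

/-- The increments of the path `w` after time `h`, indexed by `ℝ`. -/
def shiftIncr (h : ℝ) (w : ℝ → ℝ) : ℝ → ℝ := fun s => w (h + s) - w h

/-- The path `w` stopped at time `0`. -/
def pastPath (w : ℝ → ℝ) : ℝ → ℝ := fun s => w (min s 0)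

/-- The path `w` started at time `0`. -/
def futurePath (w : ℝ → ℝ) : ℝ → ℝ := fun s => w (max s 0)

/-- Two-sided real Lévy processes, as random càdlàg paths. -/
structure IsTwoSidedLevy [MeasurableSpace Ω] (Y : Ω → ℝ → ℝ) (P : Measure Ω) : Prop where
  measurable : Measurable Y
  cadlag : ∀ ω, IsCadlag (Y ω)
  zero : ∀ᵐ ω ∂P, Y ω 0 = 0
  stationary : ∀ h, IdentDistrib (fun ω => shiftIncr h (Y ω)) Y P P
  indep : IndepFun (fun ω => pastPath (Y ω)) (fun ω => futurePath (Y ω)) P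

lemma measurable_shiftIncr (h : ℝ) : Measurable (shiftIncr h) :=
  measurable_pi_lambda _ fun _ => (measurable_pi_apply _).sub (measurable_pi_apply _)

lemma measurable_pastPath : Measurable pastPath :=
  measurable_pi_lambda _ fun _ => measurable_pi_apply _

lemma measurable_futurePath : Measurable futurePath :=
  measurable_pi_lambda _ fun _ => measurable_pi_apply _

variable [MeasurableSpace Ω] {P : Measure Ω}

/-- A process with `Y 0 = 0` that has independent increments with stationary laws, along every
monotone sequence of times that passes through `0`, has stationary increments as a process. -/
lemma identDistrib_shiftIncr_of_increments [IsProbabilityMeasure P] {Y : Ω → ℝ → ℝ}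
    (hm : Measurable Y) (h0 : ∀ᵐ ω ∂P, Y ω 0 = 0)
    (hi : ∀ t : ℕ → ℝ, Monotone t → (∃ k, t k = 0) →
      iIndepFun (fun i ω => Y ω (t (i + 1)) - Y ω (t i)) P)
    (hs : ∀ a b c d : ℝ, a ≤ b → b - a = d - c → (0 ≤ a ∨ b ≤ 0) → (0 ≤ c ∨ d ≤ 0) →
      IdentDistrib (fun ω => Y ω b - Y ω a) (fun ω => Y ω d - Y ω c) P P) (h : ℝ) :
    IdentDistrib (fun ω => shiftIncr h (Y ω)) Y P P := by
  classical
  have hmt : ∀ t, Measurable fun ω => Y ω t := fun t => (measurable_pi_apply t).comp hm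
  refine (identDistrib_iff_forall_finset_identDistrib
    (X := fun s ω => shiftIncr h (Y ω) s) (Y := fun s ω => Y ω s)
    ((measurable_shiftIncr h).comp hm).aemeasurable hm.aemeasurable).2 fun J => ?_
  -- The grid contains 0 and h, so both it and its translate by -h pass through 0. Hence no grid
  -- interval, translated or not, straddles 0, and both hypotheses on the increments apply to the
  -- two grids.
  obtain ⟨t, ht, hcov⟩ := Finset.exists_monotone_nat_cover
    (K := insert 0 (insert h (J.image fun s => h + s))) ⟨0, by simp⟩
  obtain ⟨k, hk⟩ := hcov 0 (by simp)
  obtain ⟨l, hl⟩ := hcov h (by simp)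
  have hJ : ∀ s : J, ∃ i, t i = h + s := fun s => hcov _ (by simp)
  choose r hr using hJ
  have hD : IdentDistrib (fun ω (i : ℕ) => Y ω (t (i + 1)) - Y ω (t i))
      (fun ω (i : ℕ) => Y ω (t (i + 1) - h) - Y ω (t i - h)) P P := by
    have hside : ∀ i j, 0 ≤ t i - t j ∨ t (i + 1) - t j ≤ 0 := fun i j => by
      rcases Nat.lt_or_ge i j with hij | hij
      · exact Or.inr (sub_nonpos.2 (ht hij))
      · exact Or.inl (sub_nonneg.2 (ht hij))
    refine IdentDistrib.pi (fun i => hs _ _ _ _ (ht (Nat.le_succ i)) (by ring) ?_ ?_)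
      (hi t ht ⟨k, hk⟩) ?_
    · simpa [hk] using hside i k
    · simpa only [hl] using hside i l
    exact hi (fun i => t i - h) (fun i j hij => sub_le_sub_right (ht hij) h) ⟨l, by simp [hl]⟩
  -- The coordinates at `h + s`, relative to h, are recovered from the increments by telescoping.
  have hG : Measurable fun (d : ℕ → ℝ) (s : J) =>
      ∑ i ∈ Finset.range (r s), d i - ∑ i ∈ Finset.range l, d i := by fun_prop
  have hfin := hD.comp hG
  refine (IdentDistrib.of_ae_eq ?_ ?_).trans (hfin.trans (IdentDistrib.of_ae_eq ?_ ?_))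
  · exact (measurable_pi_lambda _ fun s => ((hmt _).sub (hmt _))).aemeasurable
  · refine Eventually.of_forall fun ω => ?_
    funext s
    simp only [Finset.restrict, shiftIncr, Function.comp]
    rw [Finset.sum_range_sub (fun i => Y ω (t i)), Finset.sum_range_sub (fun i => Y ω (t i)), hr,
      hl]
    ring
  · exact hfin.aemeasurable_snd
  · filter_upwards [h0] with ω hω
    funext s
    simp only [Finset.restrict, Function.comp]
    rw [Finset.sum_range_sub (fun i => Y ω (t i - h)),
      Finset.sum_range_sub (fun i => Y ω (t i - h)), hr, hl]
    simp [hω]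

end TwoSided

/-! ### The process glued from `ξ` and its independent dual is a two-sided Lévy process. -/

section Dual

variable [MeasurableSpace Ω] {P : Measure Ω} {ξ η : ℝ≥0 → Ω → ℝ}

lemma IsIndepDual.identDistrib_sub (hη : IsIndepDual ξ η P) (s t : ℝ≥0) :
    IdentDistrib (fun ω => η t ω - η s ω) (fun ω => ξ s ω - ξ t ω) P P := by
  have h := hη.law.comp (u := fun w : ℝ≥0 → ℝ => w t - w s) (by fun_prop)
  convert h using 1
  · rfl
  · funext ω
    change _ = -ξ t ω - -ξ s ω
    ring

lemma IsIndepDual.ae_zero (hξ : IsLevyProcess ξ P) (hη : IsIndepDual ξ η P) :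
    ∀ᵐ ω ∂P, η 0 ω = 0 := by
  refine hη.law.symm.ae_snd (p := fun w => w 0 = 0) ?_ ?_
  · exact measurableSet_eq_fun (measurable_pi_apply _) measurable_const
  · filter_upwards [hξ.zero] with ω hω
    simp [hω]

/-- Independence says that the joint law of the increments is a product, which depends only on the
law of the process. -/
lemma IsIndepDual.hasIndepIncrements [IsProbabilityMeasure P] (hξ : IsLevyProcess ξ P)
    (hη : IsIndepDual ξ η P) : HasIndepIncrements η P := by
  intro n t ht
  have h := hξ.indep.neg n t ht
  have hu : Measurable fun (w : ℝ≥0 → ℝ) (i : Fin n) => w (t i.succ) - w (t i.castSucc) := by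
    fun_prop
  have hid := hη.law.comp hu
  have hme : ∀ i : Fin n, AEMeasurable (fun ω => η (t i.succ) ω - η (t i.castSucc) ω) P :=
    fun i => ((hη.measurable _).sub (hη.measurable _)).aemeasurable
  have hmx : ∀ i : Fin n, AEMeasurable (fun ω => (-ξ) (t i.succ) ω - (-ξ) (t i.castSucc) ω) P :=
    fun i => ((hξ.measurable _).neg.sub (hξ.measurable _).neg).aemeasurable
  rw [iIndepFun_iff_map_fun_eq_pi_map hme]
  rw [iIndepFun_iff_map_fun_eq_pi_map hmx] at h
  refine hid.map_eq.trans (h.trans ?_)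
  congr 1
  funext i
  exact ((hη.law.comp (u := fun w : ℝ≥0 → ℝ => w (t i.succ) - w (t i.castSucc))
    (by fun_prop)).map_eq).symm

/-- A Lévy process has no fixed times of discontinuity. -/
lemma IsIndepDual.ae_leftLim_eq [IsProbabilityMeasure P] (hξ : IsLevyProcess ξ P)
    (hη : IsIndepDual ξ η P) {t : ℝ} (ht : 0 < t) :
    ∀ᵐ ω ∂P, Function.leftLim (fun s => η s ω) t.toNNReal = η t.toNNReal ω := by
  obtain ⟨N, hN⟩ := exists_nat_one_div_lt ht
  set e : ℕ → ℝ := fun n => 1 / (((n + N : ℕ) : ℝ) + 1) with he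
  have he0 : ∀ n, 0 < e n := fun n => by positivity
  have het : ∀ n, e n < t := fun n => lt_of_le_of_lt
    (one_div_le_one_div_of_le (by positivity) (by push_cast; linarith [n.cast_nonneg (α := ℝ)])) hN
  have helim : Tendsto e atTop (𝓝 0) :=
    (tendsto_one_div_add_atTop_nhds_zero_nat (𝕜 := ℝ)).comp (tendsto_add_atTop_nat N)
  -- A bounded continuous function that vanishes only at 0. The increment of `η` over `[t - e n, t]`
  -- has the law of `-ξ (e n)`, which tends to 0, so the jump `D` at t satisfies `∫ φ(D) = 0`.
  set φ : ℝ → ℝ := fun x => min |x| 1 with hφ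
  have hφc : Continuous φ := by fun_prop
  have hφb : ∀ x, ‖φ x‖ ≤ 1 := fun x => by
    rw [Real.norm_eq_abs, abs_of_nonneg (le_min (abs_nonneg x) zero_le_one)]
    exact min_le_right _ _
  set D : Ω → ℝ := fun ω => η t.toNNReal ω - Function.leftLim (fun s => η s ω) t.toNNReal with hD
  have hlim : ∀ ω, Tendsto (fun n => η t.toNNReal ω - η (t - e n).toNNReal ω) atTop (𝓝 (D ω)) := by
    intro ω
    refine tendsto_const_nhds.sub ?_
    rw [leftLim_toNNReal (hη.cadlag ω) ht]
    refine ((hη.cadlag ω).comp_toNNReal.tendsto_leftLim t).comp (tendsto_nhdsWithin_iff.2 ⟨?_, ?_⟩)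
    · simpa using helim.const_sub t
    · exact Eventually.of_forall fun n => by simpa using he0 n
  have hDm : Measurable D := measurable_of_tendsto_metrizable
    (fun n => (hη.measurable _).sub (hη.measurable _)) (tendsto_pi_nhds.2 hlim)
  have h1 : Tendsto (fun n => ∫ ω, φ (η t.toNNReal ω - η (t - e n).toNNReal ω) ∂P) atTop
      (𝓝 (∫ ω, φ (D ω) ∂P)) := by
    refine tendsto_integral_of_dominated_convergence (fun _ => 1) (fun n => ?_)
      (integrable_const _) (fun n => Eventually.of_forall fun ω => hφb _)
      (Eventually.of_forall fun ω => (hφc.tendsto _).comp (hlim ω))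
    exact (hφc.measurable.comp ((hη.measurable _).sub (hη.measurable _))).aestronglyMeasurable
  have h2 : Tendsto (fun n => ∫ ω, φ (-ξ (e n).toNNReal ω) ∂P) atTop (𝓝 (∫ ω, φ 0 ∂P)) := by
    refine tendsto_integral_of_dominated_convergence (fun _ => 1) (fun n => ?_)
      (integrable_const _) (fun n => Eventually.of_forall fun ω => hφb _) ?_
    · exact (hφc.measurable.comp (hξ.measurable _).neg).aestronglyMeasurable
    · filter_upwards [hξ.zero] with ω hω
      refine (hφc.tendsto _).comp ?_
      have h := ((hξ.cadlag ω).comp_toNNReal 0).1.tendsto.comp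
        (tendsto_nhdsWithin_iff.2 ⟨helim, Eventually.of_forall fun n => (he0 n).le⟩)
      simpa [hω] using h.neg
  have h3 : ∀ n, ∫ ω, φ (η t.toNNReal ω - η (t - e n).toNNReal ω) ∂P =
      ∫ ω, φ (-ξ (e n).toNNReal ω) ∂P := by
    intro n
    have hsum : (t - e n).toNNReal + (e n).toNNReal = t.toNNReal := by
      rw [← Real.toNNReal_add (by linarith [het n]) (he0 n).le]
      congr 1
      ring
    have h4 := (hη.identDistrib_sub (t - e n).toNNReal t.toNNReal).trans
      (g := fun ω => ξ (t - e n).toNNReal ω - ξ t.toNNReal ω) (h := fun ω => -ξ (e n).toNNReal ω)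
      (by
        have h5 := (hξ.stationary (t - e n).toNNReal (e n).toNNReal).comp measurable_neg
        rw [hsum] at h5
        convert h5 using 1
        · funext ω
          change _ = -(ξ t.toNNReal ω - ξ (t - e n).toNNReal ω)
          ring
        · rfl)
    exact (h4.comp hφc.measurable).integral_eq
  have h6 : ∫ ω, φ (D ω) ∂P = 0 := by
    simp_rw [h3] at h1
    rw [tendsto_nhds_unique h1 h2]
    simp [hφ]
  have h7 : (fun ω => φ (D ω)) =ᵐ[P] 0 := by
    rw [← integral_eq_zero_iff_of_nonneg (fun ω => le_min (abs_nonneg _) zero_le_one) ?_]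
    · exact h6
    · exact (integrable_const (1 : ℝ)).mono' (hφc.measurable.comp hDm).aestronglyMeasurable
        (Eventually.of_forall fun ω => hφb _)
  filter_upwards [h7] with ω hω
  have h8 : min |D ω| 1 = 0 := hω
  rcases min_choice |D ω| 1 with h | h
  · rw [h, abs_eq_zero] at h8
    simp only [hD] at h8
    linarith
  · rw [h] at h8
    exact absurd h8 one_ne_zero

lemma IsIndepDual.ae_twoSided_eq [IsProbabilityMeasure P] (hξ : IsLevyProcess ξ P)
    (hη : IsIndepDual ξ η P) {t : ℝ} (ht : t ≤ 0) :
    twoSided ξ η t =ᵐ[P] η (-t).toNNReal := by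
  rcases ht.eq_or_lt with rfl | ht
  · filter_upwards [hξ.zero, hη.ae_zero hξ] with ω h1 h2
    rw [twoSided_of_nonneg _ _ le_rfl]
    simp [h1, h2]
  · filter_upwards [hη.ae_leftLim_eq hξ (neg_pos.2 ht)] with ω hω
    rw [twoSided, if_neg (not_le.2 ht), hω]

lemma measurable_twoSided (hξ : IsLevyProcess ξ P) (hη : IsIndepDual ξ η P) (t : ℝ) :
    Measurable (twoSided ξ η t) := by
  rcases le_or_gt 0 t with ht | ht
  · convert hξ.measurable t.toNNReal using 1
    ext ω
    exact twoSided_of_nonneg _ _ ht ω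
  · have hlim : ∀ ω, Tendsto (fun n : ℕ => η (-t - 1 / ((n : ℝ) + 1)).toNNReal ω) atTop
        (𝓝 (twoSided ξ η t ω)) := by
      intro ω
      rw [twoSided_eq (hη.cadlag ω), if_neg (not_le.2 ht)]
      refine ((hη.cadlag ω).comp_toNNReal.tendsto_leftLim (-t)).comp
        (tendsto_nhdsWithin_iff.2 ⟨?_, Eventually.of_forall fun n => ?_⟩)
      · simpa using (tendsto_one_div_add_atTop_nhds_zero_nat (𝕜 := ℝ)).const_sub (-t)
      · simp only [mem_Iio, sub_lt_self_iff]
        positivity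
    exact measurable_of_tendsto_metrizable (fun n => hη.measurable _) (tendsto_pi_nhds.2 hlim)

lemma identDistrib_twoSided_sub [IsProbabilityMeasure P] (hξ : IsLevyProcess ξ P)
    (hη : IsIndepDual ξ η P) {a b : ℝ} (hab : a ≤ b) (hsign : 0 ≤ a ∨ b ≤ 0) :
    IdentDistrib (fun ω => twoSided ξ η b ω - twoSided ξ η a ω) (ξ (b - a).toNNReal) P P := by
  rcases hsign with ha | hb
  · have h := hξ.stationary a.toNNReal (b - a).toNNReal
    rw [← Real.toNNReal_add ha (by linarith), add_sub_cancel] at h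
    convert h using 1
    ext ω
    rw [twoSided_of_nonneg _ _ ha, twoSided_of_nonneg _ _ (ha.trans hab)]
  · have h := hξ.stationary (-b).toNNReal (b - a).toNNReal
    rw [← Real.toNNReal_add (by linarith) (by linarith), show -b + (b - a) = -a by ring] at h
    refine (IdentDistrib.of_ae_eq ((measurable_twoSided hξ hη b).sub
      (measurable_twoSided hξ hη a)).aemeasurable ?_).trans
      ((hη.identDistrib_sub (-a).toNNReal (-b).toNNReal).trans h)
    filter_upwards [hη.ae_twoSided_eq hξ hb, hη.ae_twoSided_eq hξ (hab.trans hb)] with ω h1 h2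
    rw [Pi.sub_apply, h1, h2]

lemma iIndepFun_twoSided_increments [IsProbabilityMeasure P] (hξ : IsLevyProcess ξ P)
    (hη : IsIndepDual ξ η P) {t : ℕ → ℝ} (ht : Monotone t) {k : ℕ} (hk : t k = 0) :
    iIndepFun (fun i ω => twoSided ξ η (t (i + 1)) ω - twoSided ξ η (t i) ω) P := by
  have hneg : ∀ i, i < k → t (i + 1) ≤ 0 := fun i hi => hk ▸ ht hi
  have hpos : ∀ i, ¬ i < k → 0 ≤ t i := fun i hi => hk ▸ ht (not_lt.1 hi)
  set D : ℕ → Ω → ℝ := fun i ω =>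
    if i < k then η (-t (i + 1)).toNNReal ω - η (-t i).toNNReal ω
    else ξ (t (i + 1)).toNNReal ω - ξ (t i).toNNReal ω with hD
  refine iIndepFun.congr (f := D) (fun i => ?_) ?_
  · by_cases hi : i < k
    · filter_upwards [hη.ae_twoSided_eq hξ (hneg i hi),
        hη.ae_twoSided_eq hξ ((ht (Nat.le_succ i)).trans (hneg i hi))] with ω h1 h2
      rw [h1, h2]
      simp [hD, hi]
    · refine Eventually.of_forall fun ω => ?_
      simp only [hD, hi, if_false]
      rw [twoSided_of_nonneg _ _ (hpos i hi),
        twoSided_of_nonneg _ _ ((hpos i hi).trans (ht (Nat.le_succ i)))]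
  · refine iIndepFun_of_indepFun_of_split (fun i => i < k) hη.indep.symm (fun i hi => ?_)
      (fun i hi => ?_) ?_ ?_
    · refine ⟨fun w => w (-t (i + 1)).toNNReal - w (-t i).toNNReal, by fun_prop, ?_⟩
      ext ω
      simp [hD, hi]
    · refine ⟨fun w => w (t (i + 1)).toNNReal - w (t i).toNNReal, by fun_prop, ?_⟩
      ext ω
      simp [hD, hi]
    -- On the negative side time runs backwards: the order of the indices is reversed, by `i ↦ k - 1
    -- - i`, and the increments change sign.
    · have hmono : Monotone fun j => (-t (k - j)).toNNReal := fun i j hij =>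
        Real.toNNReal_mono (neg_le_neg (ht (Nat.sub_le_sub_left hij k)))
      have h := ((hη.hasIndepIncrements hξ).nat hmono).precomp
        (g := fun i : {i // i < k} => k - 1 - i.1) (fun i j hij => by
          have := i.2
          have := j.2
          ext
          simp only at hij
          omega)
      have h' := h.comp (fun _ => fun x => -x) (fun _ => measurable_neg)
      convert h' using 1
      funext i
      ext ω
      have hi := i.2
      have e1 : k - (k - 1 - i.1 + 1) = i.1 := by omega
      have e2 : k - (k - 1 - i.1) = i.1 + 1 := by omega
      simp only [hD, hi, if_true, Function.comp, e1, e2]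
      ring
    · have h := (hξ.indep.nat (t := fun i => (t i).toNNReal)
        fun i j hij => Real.toNNReal_mono (ht hij)).precomp
        (g := fun i : {i // ¬ i < k} => i.1) Subtype.val_injective
      convert h using 1
      funext i
      ext ω
      have hi := i.2
      simp only [hD, hi, if_false]

lemma isTwoSidedLevy_twoSided [IsProbabilityMeasure P] (hξ : IsLevyProcess ξ P)
    (hη : IsIndepDual ξ η P) : IsTwoSidedLevy (fun ω t => twoSided ξ η t ω) P where
  measurable := measurable_pi_lambda _ (measurable_twoSided hξ hη)
  cadlag ω := isCadlag_twoSided (hξ.cadlag ω) (hη.cadlag ω)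
  zero := by
    filter_upwards [hξ.zero] with ω hω
    rw [twoSided_of_nonneg _ _ le_rfl]
    simpa using hω
  stationary := by
    refine identDistrib_shiftIncr_of_increments
      (measurable_pi_lambda _ (measurable_twoSided hξ hη)) ?_ ?_ ?_
    · filter_upwards [hξ.zero] with ω hω
      rw [twoSided_of_nonneg _ _ le_rfl]
      simpa using hω
    · rintro t ht ⟨k, hk⟩
      exact iIndepFun_twoSided_increments hξ hη ht hk
    · intro a b c d hab hd h1 h2
      exact (identDistrib_twoSided_sub hξ hη hab h1).trans
        (hd ▸ (identDistrib_twoSided_sub hξ hη (by linarith) h2).symm)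
  indep := by
    have h := hη.indep.symm.comp (φ := fun w (s : ℝ) => w (-min s 0).toNNReal)
      (ψ := fun w (s : ℝ) => w (max s 0).toNNReal) (by fun_prop) (by fun_prop)
    -- The two-sided process agrees with the dual only almost surely at each fixed time; that is
    -- enough for independence of the processes.
    refine IndepFun.process_congr
      (X := fun s : ℝ => η (-min s 0).toNNReal) (Y := fun s : ℝ => ξ (max s 0).toNNReal)
      (X' := fun s ω => twoSided ξ η (min s 0) ω) (Y' := fun s ω => twoSided ξ η (max s 0) ω)
      ?_ (fun s => ?_) (fun s => ?_)
    · exact h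
    · exact (hη.ae_twoSided_eq hξ (min_le_right s 0)).symm
    · exact Eventually.of_forall fun ω => (twoSided_of_nonneg _ _ (le_max_right s 0) ω).symm

end Dual

/-! ### Strong mixing and ergodicity of the flow of increments. -/

section Mixing

/-- Mixing is inherited from a measure-dense family of sets. -/
lemma MeasureTheory.Measure.MeasureDense.tendsto_measureReal_inter_preimage {ι α : Type*}
    [MeasurableSpace α] {μ : Measure α} [IsProbabilityMeasure μ] {𝒜 : Set (Set α)}
    (h𝒜 : μ.MeasureDense 𝒜) {T : ι → α → α} (hT : ∀ t, MeasurePreserving (T t) μ μ)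
    {l : Filter ι} (h : ∀ A ∈ 𝒜, ∀ B ∈ 𝒜,
      Tendsto (fun t => μ.real (A ∩ T t ⁻¹' B)) l (𝓝 (μ.real A * μ.real B)))
    {A B : Set α} (hA : MeasurableSet A) (hB : MeasurableSet B) :
    Tendsto (fun t => μ.real (A ∩ T t ⁻¹' B)) l (𝓝 (μ.real A * μ.real B)) := by
  have real_lt : ∀ (C D : Set α) (ε : ℝ), 0 < ε → μ (symmDiff C D) < ENNReal.ofReal ε →
      μ.real (symmDiff C D) < ε := fun C D ε hε h =>
    (ENNReal.toReal_lt_toReal (measure_ne_top _ _) ENNReal.ofReal_ne_top).2 h |>.trans_eq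
      (ENNReal.toReal_ofReal hε.le)
  rw [Metric.tendsto_nhds]
  intro ε hε
  -- Five errors: A and B are each replaced once in the intersection and once in the product, and
  -- the fifth is the limit for the approximants. Invariance of μ makes the errors for B independent
  -- of t.
  obtain ⟨A', hA', hAA'⟩ := h𝒜.approx A hA (measure_ne_top _ _) (ε / 5) (by positivity)
  obtain ⟨B', hB', hBB'⟩ := h𝒜.approx B hB (measure_ne_top _ _) (ε / 5) (by positivity)
  replace hAA' := real_lt _ _ _ (by positivity) hAA'
  replace hBB' := real_lt _ _ _ (by positivity) hBB'
  have hmA' := h𝒜.measurable A' hA'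
  have hmB' := h𝒜.measurable B' hB'
  have h1 := abs_measureReal_sub_le_measureReal_symmDiff (μ := μ)
    hA.nullMeasurableSet hmA'.nullMeasurableSet
  have h2 := abs_measureReal_sub_le_measureReal_symmDiff (μ := μ)
    hB.nullMeasurableSet hmB'.nullMeasurableSet
  filter_upwards [Metric.tendsto_nhds.1 (h A' hA' B' hB') (ε / 5) (by positivity)] with t ht
  have hTm := (hT t).measurable
  have h3 := abs_measureReal_sub_le_measureReal_symmDiff (μ := μ)
    (hA.inter (hTm hB)).nullMeasurableSet (hmA'.inter (hTm hmB')).nullMeasurableSet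
  have h4 : μ.real (symmDiff (A ∩ T t ⁻¹' B) (A' ∩ T t ⁻¹' B')) ≤
      μ.real (symmDiff A A') + μ.real (symmDiff B B') := by
    have h5 : μ.real (T t ⁻¹' (symmDiff B B')) = μ.real (symmDiff B B') := by
      rw [measureReal_def, (hT t).measure_preimage ((hB.symmDiff hmB').nullMeasurableSet),
        measureReal_def]
    rw [← h5]
    refine (measureReal_mono ?_).trans (measureReal_union_le _ _)
    intro x hx
    simp only [Set.mem_symmDiff, mem_inter_iff, mem_preimage, mem_union] at hx ⊢
    tauto
  have h6 : |μ.real A * μ.real B - μ.real A' * μ.real B'| ≤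
      |μ.real A - μ.real A'| + |μ.real B - μ.real B'| := by
    have e : μ.real A * μ.real B - μ.real A' * μ.real B' =
        (μ.real A - μ.real A') * μ.real B + μ.real A' * (μ.real B - μ.real B') := by ring
    rw [e]
    refine (abs_add_le _ _).trans (add_le_add ?_ ?_)
    · rw [abs_mul, abs_of_nonneg (measureReal_nonneg (s := B))]
      exact mul_le_of_le_one_right (abs_nonneg _) measureReal_le_one
    · rw [abs_mul, abs_of_nonneg (measureReal_nonneg (s := A'))]
      exact mul_le_of_le_one_left (abs_nonneg _) measureReal_le_one
  rw [Real.dist_eq] at ht ⊢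
  rw [abs_lt] at ht ⊢
  rw [abs_le] at h1 h2 h3
  have h7 := abs_le.1 h6
  have h8 : |μ.real A - μ.real A'| ≤ μ.real (symmDiff A A') := abs_le.2 h1
  have h9 : |μ.real B - μ.real B'| ≤ μ.real (symmDiff B B') := abs_le.2 h2
  constructor <;> linarith [ht.1, ht.2, h3.1, h3.2, h7.1, h7.2]

lemma shiftIncr_shiftIncr (h k : ℝ) (w : ℝ → ℝ) :
    shiftIncr h (shiftIncr k w) = shiftIncr (k + h) w := by
  funext s
  simp only [shiftIncr]
  ring_nf

variable [MeasurableSpace Ω] {P : Measure Ω} {Y : Ω → ℝ → ℝ}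

namespace IsTwoSidedLevy

lemma measurePreserving (hY : IsTwoSidedLevy Y P) (h : ℝ) :
    MeasurePreserving (shiftIncr h) (P.map Y) (P.map Y) :=
  ⟨measurable_shiftIncr h, by
    rw [Measure.map_map (measurable_shiftIncr h) hY.measurable]
    exact (hY.stationary h).map_eq⟩

/-- The past and the future of the increments at any time are independent. -/
lemma indepFun_past_future [IsProbabilityMeasure P] (hY : IsTwoSidedLevy Y P) (h : ℝ) :
    IndepFun (fun ω => pastPath (shiftIncr h (Y ω))) (fun ω => futurePath (shiftIncr h (Y ω)))
      P := by
  refine indepFun_of_identDistrib_pair hY.indep ?_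
  exact ((hY.stationary h).comp (measurable_pastPath.prodMk measurable_futurePath)).symm

/-- Cut at time r. As `Y 0 = 0`, the coordinates in `I` are recovered from the increments before r;
since `t - r ≥ r`, the shifted coordinates in `J` only see increments after r. -/
lemma measure_inter_cylinder [IsProbabilityMeasure P] (hY : IsTwoSidedLevy Y P) {I J : Finset ℝ}
    {S : Set (I → ℝ)} {S' : Set (J → ℝ)} (hS : MeasurableSet S) (hS' : MeasurableSet S') {r t : ℝ}
    (hr : 0 ≤ r) (hI : ∀ s ∈ I, |s| ≤ r) (hJ : ∀ s ∈ J, |s| ≤ r) (ht : 2 * r ≤ t) :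
    P.map Y (cylinder I S ∩ shiftIncr t ⁻¹' cylinder J S') =
      P.map Y (cylinder I S) * P.map Y (cylinder J S') := by
  have hmS : MeasurableSet (cylinder I S) := MeasurableSet.cylinder (α := fun _ : ℝ => ℝ) I hS
  have hmS' : MeasurableSet (cylinder J S') := MeasurableSet.cylinder (α := fun _ : ℝ => ℝ) J hS'
  have h1 : ∀ᵐ ω ∂P, (Y ω ∈ cylinder I S ↔
      shiftIncr (-r) (pastPath (shiftIncr r (Y ω))) ∈ cylinder I S) := by
    filter_upwards [hY.zero] with ω hω
    rw [mem_cylinder, mem_cylinder]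
    suffices h : I.restrict (Y ω) = I.restrict (shiftIncr (-r) (pastPath (shiftIncr r (Y ω)))) by
      rw [h]
    funext s
    have hs := abs_le.1 (hI s s.2)
    simp only [Finset.restrict, shiftIncr, pastPath]
    rw [min_eq_left (by linarith), min_eq_left (by linarith)]
    simp [hω]
  have h2 : ∀ ω, (shiftIncr t (Y ω) ∈ cylinder J S' ↔
      shiftIncr (t - r) (futurePath (shiftIncr r (Y ω))) ∈ cylinder J S') := by
    intro ω
    rw [mem_cylinder, mem_cylinder]
    suffices h : J.restrict (shiftIncr t (Y ω)) =
        J.restrict (shiftIncr (t - r) (futurePath (shiftIncr r (Y ω)))) by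
      rw [h]
    funext s
    have hs := abs_le.1 (hJ s s.2)
    simp only [Finset.restrict, shiftIncr, futurePath]
    rw [max_eq_left (by linarith), max_eq_left (by linarith)]
    ring_nf
  have hind := (hY.indepFun_past_future r).measure_inter_preimage_eq_mul _ _
    (measurable_shiftIncr (-r) hmS) (measurable_shiftIncr (t - r) hmS')
  rw [← (hY.measurePreserving t).measure_preimage hmS'.nullMeasurableSet,
    Measure.map_apply hY.measurable (hmS.inter (measurable_shiftIncr t hmS')),
    Measure.map_apply hY.measurable hmS,
    Measure.map_apply hY.measurable (measurable_shiftIncr t hmS')]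
  have e1 : P (Y ⁻¹' cylinder I S) = P ((fun ω => pastPath (shiftIncr r (Y ω))) ⁻¹'
      (shiftIncr (-r) ⁻¹' cylinder I S)) :=
    measure_congr (h1.mono fun ω hω => propext hω)
  have e2 : P (Y ⁻¹' (shiftIncr t ⁻¹' cylinder J S')) =
      P ((fun ω => futurePath (shiftIncr r (Y ω))) ⁻¹' (shiftIncr (t - r) ⁻¹' cylinder J S')) :=
    congrArg P (Set.ext h2)
  rw [e1, e2, ← hind]
  refine measure_congr ?_
  filter_upwards [h1] with ω hω
  exact propext (and_congr hω (h2 ω))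

/-- The flow of increment shifts of a two-sided Lévy process is strongly mixing. -/
lemma tendsto_measureReal [IsProbabilityMeasure P] (hY : IsTwoSidedLevy Y P)
    {A B : Set (ℝ → ℝ)} (hA : MeasurableSet A) (hB : MeasurableSet B) :
    Tendsto (fun t => (P.map Y).real (A ∩ shiftIncr t ⁻¹' B)) atTop
      (𝓝 ((P.map Y).real A * (P.map Y).real B)) := by
  have : IsProbabilityMeasure (P.map Y) := Measure.isProbabilityMeasure_map hY.measurable.aemeasurable
  refine (Measure.MeasureDense.of_generateFrom_isSetAlgebra_finite (P.map Y)
    (isSetAlgebra_measurableCylinders (α := fun _ : ℝ => ℝ))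
    generateFrom_measurableCylinders.symm).tendsto_measureReal_inter_preimage
    hY.measurePreserving ?_ hA hB
  intro A hA B hB
  obtain ⟨I, S, hS, rfl⟩ := (mem_measurableCylinders _).1 hA
  obtain ⟨J, S', hS', rfl⟩ := (mem_measurableCylinders _).1 hB
  obtain ⟨r, hr⟩ := ((I ∪ J).finite_toSet.image fun s : ℝ => |s|).bddAbove
  have hr' : ∀ s ∈ I ∪ J, |s| ≤ max r 0 := fun s hs =>
    (hr (mem_image_of_mem _ (Finset.mem_coe.2 hs))).trans (le_max_left _ _)
  refine tendsto_const_nhds.congr' ?_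
  filter_upwards [eventually_ge_atTop (2 * max r 0)] with t ht
  simp only [measureReal_def]
  rw [hY.measure_inter_cylinder hS hS' (le_max_right r 0)
    (fun s hs => hr' s (Finset.mem_union_left _ hs))
    (fun s hs => hr' s (Finset.mem_union_right _ hs)) ht, ENNReal.toReal_mul]

/-- Mixing, applied to an invariant set and itself, shows that its measure m satisfies m = m². -/
lemma ergodic [IsProbabilityMeasure P] (hY : IsTwoSidedLevy Y P) {h : ℝ} (hh : 0 < h) :
    Ergodic (shiftIncr h) (P.map Y) where
  toMeasurePreserving := hY.measurePreserving h
  aeconst_set A hA hinv := by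
    have : IsProbabilityMeasure (P.map Y) :=
      Measure.isProbabilityMeasure_map hY.measurable.aemeasurable
    -- The multiples start at 1 because `shiftIncr 0` subtracts `w 0` and is not the identity.
    have hn : ∀ n : ℕ, shiftIncr ((n + 1 : ℕ) * h) ⁻¹' A = A := by
      intro n
      induction n with
      | zero => simpa using hinv
      | succ n ih =>
        conv_rhs => rw [← ih, ← hinv]
        ext w
        simp only [mem_preimage, shiftIncr_shiftIncr]
        push_cast
        ring_nf
    have hlim := (hY.tendsto_measureReal hA hA).comp
      ((tendsto_natCast_atTop_atTop.comp (tendsto_add_atTop_nat 1)).atTop_mul_const hh)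
    have hc : (P.map Y).real A = (P.map Y).real A * (P.map Y).real A := by
      refine tendsto_nhds_unique (tendsto_const_nhds.congr fun n => ?_) hlim
      simp only [Function.comp]
      rw [hn, inter_self]
    rw [eventuallyConst_set']
    have hc' : (P.map Y).real A = 0 ∨ (P.map Y).real A = 1 := by
      rcases eq_or_ne ((P.map Y).real A) 0 with h0 | h0
      · exact Or.inl h0
      · exact Or.inr (mul_left_cancel₀ h0 (by linarith))
    rcases hc' with h0 | h1
    · left
      rw [ae_eq_empty]
      exact (measureReal_eq_zero_iff).1 h0
    · right
      rw [ae_eq_univ, prob_compl_eq_zero_iff hA]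
      rw [measureReal_def, ENNReal.toReal_eq_one_iff] at h1
      exact h1

end IsTwoSidedLevy

end Mixing

/-! ### The stationary process as a factor of the flow. -/

section Driven

lemma IsRightCts.increments {w : ℝ → ℝ} (hw : IsRightCts w) (h : ℝ) :
    IsRightCts (shiftIncr h w) := by
  intro t
  refine ContinuousWithinAt.sub ((hw (h + t)).comp (by fun_prop) fun s hs => ?_)
    continuousWithinAt_const
  simpa using hs

/-- The constant `w h` cancels between the exponential factor and the integral. Stationarity, mixing
and the ergodic theorem all pass through this identity. -/
lemma IsRightCts.gouPath_shiftIncr {w : ℝ → ℝ} (hw : IsRightCts w) (h t : ℝ) :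
    gouPath (shiftIncr h w) t = gouPath w (h + t) := by
  rw [(hw.increments h).gouPath_eq, hw.gouPath_eq]
  have h1 : ∫ s in Iic t, Real.exp (w (h + s)) = ∫ s in Iic (h + t), Real.exp (w s) := by
    have := (measurePreserving_add_left (volume : Measure ℝ) h).setIntegral_preimage_emb
      (measurableEmbedding_addLeft h) (fun s => Real.exp (w s)) (Iic (h + t))
    rw [← this]
    congr 2
    ext s
    simp
  have h2 : ∀ s, Real.exp (shiftIncr h w s) = Real.exp (-w h) * Real.exp (w (h + s)) := fun s => by
    rw [shiftIncr, ← Real.exp_add, neg_add_eq_sub]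
  simp_rw [h2]
  rw [integral_const_mul, h1, ← mul_assoc, ← Real.exp_add, shiftIncr]
  ring_nf

variable [MeasurableSpace Ω] {P : Measure Ω} {Y : Ω → ℝ → ℝ}

lemma IsTwoSidedLevy.isStationaryProcess_gouPath (hY : IsTwoSidedLevy Y P) :
    IsStationaryProcess (fun t ω => gouPath (Y ω) t) P := by
  intro h
  convert (hY.stationary h).comp measurable_gouPath_pi using 1
  · funext ω t
    simp only [Function.comp_apply]
    rw [(hY.cadlag ω).isRightCts.gouPath_shiftIncr, add_comm]
  · rfl

lemma IsTwoSidedLevy.isStronglyMixing_gouPath [IsProbabilityMeasure P] (hY : IsTwoSidedLevy Y P) :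
    IsStronglyMixing (fun t ω => gouPath (Y ω) t) P := by
  intro A B hA hB
  have hmA := measurable_gouPath_pi hA
  have hmB := measurable_gouPath_pi hB
  have : IsProbabilityMeasure (P.map Y) := Measure.isProbabilityMeasure_map hY.measurable.aemeasurable
  have h := hY.tendsto_measureReal hmA hmB
  have h' := (ENNReal.continuous_ofReal.tendsto _).comp h
  rw [ENNReal.ofReal_mul measureReal_nonneg, ofReal_measureReal, ofReal_measureReal,
    Measure.map_apply hY.measurable hmA, Measure.map_apply hY.measurable hmB] at h'
  refine h'.congr fun t => ?_
  rw [Function.comp_apply, ofReal_measureReal,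
    Measure.map_apply hY.measurable (hmA.inter (measurable_shiftIncr t hmB))]
  congr 1
  ext ω
  have e : gouPath (shiftIncr t (Y ω)) = fun s => gouPath (Y ω) (t + s) :=
    funext fun s => (hY.cadlag ω).isRightCts.gouPath_shiftIncr t s
  simp only [mem_preimage, mem_inter_iff, e]
  rfl

end Driven

/-! ### Drift to infinity implies linear growth and convergence of the integrals. -/

section Drift

lemma tendsto_twoSided {ξ η : ℝ≥0 → Ω → ℝ} {ω : Ω}
    (h : Tendsto (fun t => ξ t ω) atTop atTop) :
    Tendsto (fun t => twoSided ξ η t ω) atTop atTop := by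
  refine (h.comp Real.tendsto_toNNReal_atTop).congr' ?_
  filter_upwards [eventually_ge_atTop 0] with t ht
  exact (twoSided_of_nonneg _ _ ht ω).symm

/-- The paths that stay at least `1` above their value at `0` after time `a`. -/
def aboveAfter (a : ℝ) : Set (ℝ → ℝ) := {w | ∀ q : ℚ, a ≤ q → 1 ≤ w q - w 0}

lemma measurableSet_aboveAfter (a : ℝ) : MeasurableSet (aboveAfter a) := by
  rw [aboveAfter]
  simp only [ofPred_forall]
  exact MeasurableSet.iInter fun q => MeasurableSet.iInter fun _ =>
    measurableSet_le measurable_const (by fun_prop)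

lemma IsRightCts.one_le_of_mem_aboveAfter {w : ℝ → ℝ} (hw : IsRightCts w) {a s : ℝ}
    (h : w ∈ aboveAfter a) (has : a ≤ s) : 1 ≤ w s - w 0 := by
  refine ge_of_tendsto' (((hw s).tendsto.comp (tendsto_gridTime s)).sub_const (w 0)) fun n => ?_
  have e : gridTime n s = ((((⌊((n : ℝ) + 1) * s⌋ : ℤ) + 1) / (n + 1) : ℚ) : ℝ) := by
    rw [gridTime]
    push_cast
    rfl
  have := h (((⌊((n : ℝ) + 1) * s⌋ : ℤ) + 1) / (n + 1)) (e ▸ has.trans (lt_gridTime n s).le)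
  rw [← e] at this
  exact this

lemma iterate_shiftIncr_sub (h : ℝ) (w : ℝ → ℝ) (k : ℕ) (s : ℝ) :
    (shiftIncr h)^[k] w s - (shiftIncr h)^[k] w 0 = w (k * h + s) - w (k * h) := by
  induction k generalizing s with
  | zero => simp
  | succ k ih =>
    have h1 := ih (h + s)
    have h2 := ih h
    rw [Function.iterate_succ_apply']
    simp only [shiftIncr, add_zero]
    have e1 : ((k + 1 : ℕ) : ℝ) * h + s = k * h + (h + s) := by push_cast; ring
    have e2 : ((k + 1 : ℕ) : ℝ) * h = k * h + h := by push_cast; ring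
    rw [e1, e2]
    linarith

lemma IsRightCts.iterate {w : ℝ → ℝ} (hw : IsRightCts w) (h : ℝ) (k : ℕ) :
    IsRightCts ((shiftIncr h)^[k] w) := by
  induction k with
  | zero => exact hw
  | succ k ih => rw [Function.iterate_succ_apply']; exact ih.increments h

/-- If the times `k h` after which the path stays one unit higher have positive lower density, then
a path that tends to infinity grows at least linearly. -/
lemma IsRightCts.exists_linear_lower_bound {w : ℝ → ℝ} (hw : IsRightCts w)
    (hlim : Tendsto w atTop atTop) {h p : ℝ} (hh : 0 < h) (hp : 0 < p)
    (hb : ∀ᶠ n : ℕ in atTop,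
      n * p ≤ birkhoffSum (shiftIncr h) ((aboveAfter h).indicator fun _ => (1 : ℝ)) n w) :
    ∃ a b c : ℝ, 0 < a ∧ ∀ u, c ≤ u → a * u - b ≤ w u := by
  set S : ℕ → ℝ := fun n =>
    birkhoffSum (shiftIncr h) ((aboveAfter h).indicator fun _ => (1 : ℝ)) n w with hS
  obtain ⟨c, hc⟩ := (eventually_atTop.1 (hlim.eventually_ge_atTop 0))
  obtain ⟨n₁, hn₁⟩ := exists_nat_ge (c / h)
  rw [div_le_iff₀ hh] at hn₁
  -- From time `n₁ h` on the path is nonnegative. Each later n that is counted in `S` lifts it by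
  -- one unit above `w (n h)` from time `(n + 1) h` on.
  have claim : ∀ n, n₁ ≤ n → ∀ u, n * h ≤ u → S n - S n₁ ≤ w u := by
    intro n hn
    induction n, hn using Nat.le_induction with
    | base => intro u hu; rw [sub_self]; exact hc u (hn₁.trans hu)
    | succ n hn ih =>
      intro u hu
      push_cast at hu
      have hSn : S (n + 1) = S n + (aboveAfter h).indicator (fun _ => (1 : ℝ))
        ((shiftIncr h)^[n] w) := birkhoffSum_succ _ _ _ _
      by_cases hmem : (shiftIncr h)^[n] w ∈ aboveAfter h
      · rw [hSn, indicator_of_mem hmem]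
        have h1 := (hw.iterate h n).one_le_of_mem_aboveAfter hmem (s := u - n * h) (by linarith)
        rw [iterate_shiftIncr_sub, add_sub_cancel] at h1
        have h2 := ih (n * h) le_rfl
        linarith
      · rw [hSn, indicator_of_notMem hmem, add_zero]
        exact ih u (by linarith)
  obtain ⟨n₀, hn₀⟩ := eventually_atTop.1 hb
  -- The claim is used with n the integer part of `u / h`; the extra `p` in the intercept pays for
  -- the rounding.
  refine ⟨p / h, p + S n₁, (max n₀ n₁ : ℕ) * h + h, by positivity, fun u hu => ?_⟩
  have hu0 : 0 ≤ u / h := div_nonneg (le_trans (by positivity) hu) hh.le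
  have h1 : ((max n₀ n₁ : ℕ) : ℝ) ≤ u / h := by
    rw [le_div_iff₀ hh]
    linarith
  have hfl : max n₀ n₁ ≤ ⌊u / h⌋₊ := Nat.le_floor h1
  have h2 : (⌊u / h⌋₊ : ℝ) * h ≤ u := by
    rw [← le_div_iff₀ hh]
    exact Nat.floor_le hu0
  have h3 := claim _ ((le_max_right _ _).trans hfl) u h2
  have h4 : (⌊u / h⌋₊ : ℝ) * p ≤ S ⌊u / h⌋₊ := hn₀ _ ((le_max_left _ _).trans hfl)
  have h5 := Nat.lt_floor_add_one (u / h)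
  have h6 : p / h * u = u / h * p := by ring
  nlinarith

lemma IsCadlag.integrableOn_exp_neg {w : ℝ → ℝ} (hw : IsCadlag w) {a b c : ℝ} (ha : 0 < a)
    (h : ∀ u, c ≤ u → a * u - b ≤ w u) : IntegrableOn (fun s => Real.exp (-w s)) (Ioi 0) := by
  have hc : IntegrableOn (fun s => Real.exp (-w s)) (Icc 0 (max c 0)) :=
    ((hw.comp_continuous (g := fun x => Real.exp (-x)) (by fun_prop)).locallyIntegrable
      ).integrableOn_isCompact isCompact_Icc
  have hi : IntegrableOn (fun s => Real.exp (-w s)) (Ioi (max c 0)) := by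
    have h1 : IntegrableOn (fun s => Real.exp b * Real.exp (-a * s)) (Ioi (max c 0)) :=
      (integrableOn_exp_mul_Ioi (by linarith) _).const_mul _
    refine h1.mono' ?_ ?_
    · exact (hw.isRightCts.measurable.neg.exp).aestronglyMeasurable
    · refine (ae_restrict_mem measurableSet_Ioi).mono fun s hs => ?_
      rw [Real.norm_eq_abs, Real.abs_exp, ← Real.exp_add, Real.exp_le_exp]
      have := h s ((le_max_left c 0).trans (le_of_lt hs))
      linarith
  refine (hc.union hi).mono_set fun s hs => ?_
  rcases le_or_gt s (max c 0) with h | h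
  · exact Or.inl ⟨le_of_lt hs, h⟩
  · exact Or.inr h

variable [MeasurableSpace Ω] {P : Measure Ω} {Y : Ω → ℝ → ℝ}

/-- The events `aboveAfter (N + 1)` cover almost every path, so one of them has positive probability
and, by ergodicity, positive frequency. No moment of the increments is needed. -/
lemma IsTwoSidedLevy.ae_integrableOn_exp_neg [IsProbabilityMeasure P] (hY : IsTwoSidedLevy Y P)
    (hd : ∀ᵐ ω ∂P, Tendsto (Y ω) atTop atTop) :
    ∀ᵐ ω ∂P, IntegrableOn (fun s => Real.exp (-Y ω s)) (Ioi 0) := by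
  have : IsProbabilityMeasure (P.map Y) := Measure.isProbabilityMeasure_map hY.measurable.aemeasurable
  obtain ⟨N, hN⟩ : ∃ N : ℕ, P (Y ⁻¹' aboveAfter (N + 1)) ≠ 0 := by
    by_contra! h
    have h0 : P (⋃ N : ℕ, Y ⁻¹' aboveAfter (N + 1)) = 0 := measure_iUnion_null h
    have h1 : ∀ᵐ ω ∂P, ω ∈ ⋃ N : ℕ, Y ⁻¹' aboveAfter (N + 1) := by
      filter_upwards [hd] with ω hω
      obtain ⟨c, hc⟩ := eventually_atTop.1 (hω.eventually_ge_atTop (1 + Y ω 0))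
      obtain ⟨N, hN⟩ := exists_nat_ge c
      refine mem_iUnion.2 ⟨N, fun q hq => ?_⟩
      have := hc q (by linarith)
      linarith
    have h2 : ∀ᵐ ω ∂P, ω ∉ ⋃ N : ℕ, Y ⁻¹' aboveAfter (N + 1) := measure_eq_zero_iff_ae_notMem.1 h0
    obtain ⟨ω, h3, h4⟩ := (h1.and h2).exists
    exact h4 h3
  set h : ℝ := N + 1 with hh
  have hpos : 0 < h := by positivity
  have hms := measurableSet_aboveAfter h
  have hp : 0 < (P.map Y).real (aboveAfter h) := by
    rw [measureReal_def, Measure.map_apply hY.measurable hms]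
    exact ENNReal.toReal_pos hN (measure_ne_top _ _)
  have hB := (hY.ergodic hpos).ae_tendsto_birkhoffAverage
    (g := (aboveAfter h).indicator fun _ => (1 : ℝ)) (measurable_const.indicator hms)
    ((integrable_const _).indicator hms)
  rw [integral_indicator_const _ hms, smul_eq_mul, mul_one] at hB
  filter_upwards [hd, ae_of_ae_map hY.measurable.aemeasurable hB] with ω hω hBω
  obtain ⟨a, b, c, ha, hb⟩ := (hY.cadlag ω).isRightCts.exists_linear_lower_bound hω hpos
    (half_pos hp) (by
      filter_upwards [hBω.eventually (lt_mem_nhds (half_lt_self hp)), eventually_gt_atTop 0]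
        with n hn hn0
      have hn0' : (0 : ℝ) < n := by exact_mod_cast hn0
      rw [birkhoffAverage, smul_eq_mul, inv_mul_eq_div, lt_div_iff₀ hn0'] at hn
      linarith)
  exact (hY.cadlag ω).integrableOn_exp_neg ha hb

variable {ξ η : ℝ≥0 → Ω → ℝ}

lemma ae_integrableOn_exp_dual [IsProbabilityMeasure P] (hξ : IsLevyProcess ξ P)
    (hdrift : ∀ᵐ ω ∂P, Tendsto (fun t => ξ t ω) atTop atTop) (hη : IsIndepDual ξ η P) :
    ∀ᵐ ω ∂P, IntegrableOn (fun s : ℝ => Real.exp (η s.toNNReal ω)) (Ioi 0) := by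
  have h1 := (isTwoSidedLevy_twoSided hξ hη).ae_integrableOn_exp_neg
    (hdrift.mono fun ω hω => tendsto_twoSided hω)
  -- Convergence becomes a measurable event on path space, so it passes from `-ξ` to `η` by equality
  -- of laws.
  set G : (ℝ → ℝ) → ENNReal := fun w => ∫⁻ s in Ioi (0 : ℝ), ENNReal.ofReal (Real.exp (regPath w s))
    with hG
  have hGm : Measurable G := by
    have h : Measurable fun q : (ℝ → ℝ) × ℝ => ENNReal.ofReal (Real.exp (regPath q.1 q.2)) :=
      (Measurable.regPath measurable_fst measurable_snd).exp.ennreal_ofReal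
    exact h.lintegral_prod_right'
  have hGi : ∀ w : ℝ → ℝ, IsRightCts w →
      (G w < ⊤ ↔ IntegrableOn (fun s => Real.exp (w s)) (Ioi 0)) := by
    intro w hw
    rw [IntegrableOn, ← lintegral_ofReal_ne_top_iff_integrable
      (hw.measurable.exp).aestronglyMeasurable (Eventually.of_forall fun s => (Real.exp_pos _).le),
      lt_top_iff_ne_top]
    simp only [hG, hw.regPath_eq]
  have hlaw : IdentDistrib (fun ω (s : ℝ) => -ξ s.toNNReal ω) (fun ω (s : ℝ) => η s.toNNReal ω)
      P P := by
    have hu : Measurable fun (w : ℝ≥0 → ℝ) (s : ℝ) => w s.toNNReal := by fun_prop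
    exact (hη.law.comp hu).symm
  have h2 : ∀ᵐ ω ∂P, G (fun s => η s.toNNReal ω) < ⊤ := by
    refine hlaw.ae_snd (p := fun w => G w < ⊤) (measurableSet_lt hGm measurable_const) ?_
    filter_upwards [h1] with ω hω
    rw [hGi _ ((hξ.cadlag ω).comp_toNNReal.comp_continuous continuous_neg).isRightCts]
    refine hω.congr_fun (fun s hs => ?_) measurableSet_Ioi
    simp only
    rw [twoSided_of_nonneg _ _ (le_of_lt hs)]
  filter_upwards [h2] with ω hω
  exact (hGi _ (hη.cadlag ω).comp_toNNReal.isRightCts).1 hω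

/-- Almost surely, the two-sided process agrees with the reflected dual at almost all negative
times. -/
lemma IsIndepDual.ae_ae_twoSided_eq [IsProbabilityMeasure P] (hξ : IsLevyProcess ξ P)
    (hη : IsIndepDual ξ η P) :
    ∀ᵐ ω ∂P, ∀ᵐ s ∂volume.restrict (Iic (0 : ℝ)), twoSided ξ η s ω = η (-s).toNNReal ω := by
  have hY := isTwoSidedLevy_twoSided hξ hη
  have hm1 : Measurable fun p : ℝ × Ω => twoSided ξ η p.1 p.2 := by
    have h : Measurable fun p : ℝ × Ω => regPath (fun t => twoSided ξ η t p.2) p.1 :=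
      (hY.measurable.comp measurable_snd).regPath measurable_fst
    convert h using 2 with p
    rw [(hY.cadlag p.2).isRightCts.regPath_eq]
  have hm2 : Measurable fun p : ℝ × Ω => η (-p.1).toNNReal p.2 := by
    have hm : Measurable fun (ω : Ω) (t : ℝ) => η t.toNNReal ω :=
      measurable_pi_lambda _ fun t => hη.measurable _
    have h : Measurable fun p : ℝ × Ω => regPath (fun t => η t.toNNReal p.2) (-p.1) :=
      (hm.comp measurable_snd).regPath measurable_fst.neg
    convert h using 2 with p
    rw [(hη.cadlag p.2).comp_toNNReal.isRightCts.regPath_eq]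
  -- Fubini: equality almost surely at each time gives, almost surely, equality at almost every
  -- time, which suffices under the integral.
  rw [← Measure.ae_ae_comm (p := fun s ω => twoSided ξ η s ω = η (-s).toNNReal ω)
    (measurableSet_eq_fun hm1 hm2)]
  refine (ae_restrict_mem measurableSet_Iic).mono fun s hs => ?_
  exact hη.ae_twoSided_eq hξ hs

lemma ae_integrableOn_exp_twoSided [IsProbabilityMeasure P] (hξ : IsLevyProcess ξ P)
    (hdrift : ∀ᵐ ω ∂P, Tendsto (fun t => ξ t ω) atTop atTop) (hη : IsIndepDual ξ η P) :
    ∀ᵐ ω ∂P, ∀ t : ℝ, IntegrableOn (fun s => Real.exp (twoSided ξ η s ω)) (Iic t) := by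
  filter_upwards [ae_integrableOn_exp_dual hξ hdrift hη, hη.ae_ae_twoSided_eq hξ] with ω h1 h2 t
  have h3 : IntegrableOn (fun s : ℝ => Real.exp (η (-s).toNNReal ω)) (Iic 0) := by
    rw [integrableOn_Iic_iff_integrableOn_Iio]
    have h := ((Measure.measurePreserving_neg (volume : Measure ℝ)).integrableOn_comp_preimage
      (MeasurableEquiv.neg ℝ).measurableEmbedding).2 h1
    rw [neg_preimage, neg_Ioi, neg_zero] at h
    exact h
  have h4 : IntegrableOn (fun s => Real.exp (twoSided ξ η s ω)) (Iic 0) :=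
    h3.congr (h2.mono fun s hs => by simp only [hs])
  have h5 := ((isCadlag_twoSided (hξ.cadlag ω) (hη.cadlag ω)).comp_continuous
    Real.continuous_exp).locallyIntegrable.integrableOn_isCompact (isCompact_Icc (a := 0) (b := t))
  refine (h4.union h5).mono_set fun s hs => ?_
  rcases le_or_gt s 0 with h | h
  · exact Or.inl h
  · exact Or.inr ⟨h.le, hs⟩

lemma ae_integral_exp_twoSided [IsProbabilityMeasure P] (hξ : IsLevyProcess ξ P)
    (hη : IsIndepDual ξ η P) :
    ∀ᵐ ω ∂P, ∫ s in Iic (0 : ℝ), Real.exp (twoSided ξ η s ω) = expFunctional η ω := by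
  filter_upwards [hη.ae_ae_twoSided_eq hξ] with ω h
  rw [integral_congr_ae (h.mono fun s hs => congrArg Real.exp hs),
    integral_comp_neg_Iic 0 fun s => Real.exp (η s.toNNReal ω), neg_zero, expFunctional]

end Drift

/-! ### The affine flow, its cocycle identity and its transition kernels. -/

section Flow

lemma IsCadlag.gouFlow_add {w : ℝ → ℝ} (hw : IsCadlag w) (x s t : ℝ) :
    gouFlow x (s + t) w = gouFlow (gouFlow x s w) t (shiftIncr s w) := by
  have hr := hw.isRightCts
  rw [(hr.increments s).gouFlow_eq, hr.gouFlow_eq, hr.gouFlow_eq]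
  have h2 : ∀ r, Real.exp (shiftIncr s w r) = Real.exp (-w s) * Real.exp (w (s + r)) := fun r => by
    rw [shiftIncr, ← Real.exp_add, neg_add_eq_sub]
  simp_rw [h2]
  rw [intervalIntegral.integral_const_mul,
    intervalIntegral.integral_comp_add_left (fun r => Real.exp (w r)) s, add_zero, ← mul_add,
    ← mul_assoc, ← Real.exp_add, shiftIncr, ← add_assoc, add_comm (∫ r in s..s + t, _),
    intervalIntegral.integral_add_adjacent_intervals (hw.intervalIntegrable_exp 0 s)
      (hw.intervalIntegrable_exp s (s + t))]
  ring_nf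

/-- After time s the stationary path is the flow started from its present value and driven by the
later increments. Integrability is what allows the integral from -∞ to be split at s. -/
lemma IsCadlag.gouPath_add {w : ℝ → ℝ} (hw : IsCadlag w)
    (hi : ∀ t, IntegrableOn (fun s => Real.exp (w s)) (Iic t)) (s t : ℝ) :
    gouPath w (s + t) = gouFlow (gouPath w s) t (shiftIncr s w) := by
  have hr := hw.isRightCts
  rw [(hr.increments s).gouFlow_eq, hr.gouPath_eq, hr.gouPath_eq]
  have h2 : ∀ r, Real.exp (shiftIncr s w r) = Real.exp (-w s) * Real.exp (w (s + r)) := fun r => by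
    rw [shiftIncr, ← Real.exp_add, neg_add_eq_sub]
  simp_rw [h2]
  rw [intervalIntegral.integral_const_mul,
    intervalIntegral.integral_comp_add_left (fun r => Real.exp (w r)) s, add_zero, ← mul_add,
    ← mul_assoc, ← Real.exp_add, shiftIncr, ← intervalIntegral.integral_Iic_sub_Iic (hi s) (hi _)]
  ring_nf

lemma IsRightCts.pastPath {w : ℝ → ℝ} (hw : IsRightCts w) : IsRightCts (pastPath w) := fun t =>
  (hw (min t 0)).comp (f := fun s => min s 0) (by fun_prop) fun _ hs => mem_Ici.2 (min_le_min_right 0 (mem_Ici.1 hs))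

lemma IsRightCts.futurePath {w : ℝ → ℝ} (hw : IsRightCts w) : IsRightCts (futurePath w) := fun t =>
  (hw (max t 0)).comp (f := fun s => max s 0) (by fun_prop) fun _ hs => mem_Ici.2 (max_le_max_right 0 (mem_Ici.1 hs))

lemma IsRightCts.gouPath_pastPath {w : ℝ → ℝ} (hw : IsRightCts w) {t : ℝ} (ht : t ≤ 0) :
    gouPath (_root_.pastPath w) t = gouPath w t := by
  rw [hw.pastPath.gouPath_eq, hw.gouPath_eq]
  congr 1
  · rw [_root_.pastPath, min_eq_left ht]
  · refine setIntegral_congr_fun measurableSet_Iic fun s hs => ?_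
    rw [_root_.pastPath, min_eq_left (le_trans hs ht)]

lemma gouFlow_congr {v w : ℝ → ℝ} (hv : IsRightCts v) (hw : IsRightCts w) (x : ℝ) {t : ℝ}
    (ht : 0 ≤ t) (h : ∀ s ∈ Icc 0 t, v s = w s) : gouFlow x t v = gouFlow x t w := by
  rw [hv.gouFlow_eq, hw.gouFlow_eq, h t ⟨ht, le_rfl⟩]
  congr 2
  refine intervalIntegral.integral_congr fun s hs => ?_
  rw [uIcc_of_le ht] at hs
  simp only [h s hs]

lemma IsRightCts.gouFlow_futurePath {w : ℝ → ℝ} (hw : IsRightCts w) (x : ℝ) {t : ℝ} (ht : 0 ≤ t) :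
    gouFlow x t (_root_.futurePath w) = gouFlow x t w :=
  gouFlow_congr hw.futurePath hw x ht fun s hs => by rw [_root_.futurePath, max_eq_left hs.1]

/-- This presents the flow at time t as a function of the past at t, so that the semigroup law can
be deduced from `measure_past_inter_gouFlow`. -/
lemma IsRightCts.gouFlow_eq_pastPath {w : ℝ → ℝ} (hw : IsRightCts w) (h0 : w 0 = 0) (x : ℝ) {t : ℝ}
    (ht : 0 ≤ t) :
    gouFlow x t w = gouFlow x t (shiftIncr (-t) (_root_.pastPath (shiftIncr t w))) := by
  refine gouFlow_congr hw ((hw.increments t).pastPath.increments _) x ht fun s hs => ?_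
  simp only [shiftIncr, _root_.pastPath]
  rw [min_eq_left (by linarith [hs.2]), min_eq_left (by linarith)]
  simp [h0]

lemma gouFlow_pos {x t : ℝ} (w : ℝ → ℝ) (ht : 0 ≤ t) (hx : 0 < x) : 0 < gouFlow x t w :=
  mul_pos (Real.exp_pos _) (add_pos_of_nonneg_of_pos
    (intervalIntegral.integral_nonneg ht fun _ _ => (Real.exp_pos _).le) hx)

lemma gouFlow_nonneg {x t : ℝ} (w : ℝ → ℝ) (ht : 0 ≤ t) (hx : 0 ≤ x) : 0 ≤ gouFlow x t w :=
  mul_nonneg (Real.exp_pos _).le (add_nonneg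
    (intervalIntegral.integral_nonneg ht fun _ _ => (Real.exp_pos _).le) hx)

/-- The transition kernels of the generalized Ornstein–Uhlenbeck process driven by a random path
with law `ν`. -/
noncomputable def gouKernel (ν : Measure (ℝ → ℝ)) (t : ℝ≥0) : Kernel ℝ ℝ :=
  (Kernel.id ×ₖ Kernel.const ℝ ν).map fun p => gouFlow p.1 t p.2

lemma measurable_gouFlow_right (x t : ℝ) : Measurable (gouFlow x t) := by
  have h : Measurable fun w : ℝ → ℝ => (x, w) := measurable_const.prodMk measurable_id
  have h2 := (measurable_gouFlow t).comp h
  exact h2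

lemma gouKernel_apply (ν : Measure (ℝ → ℝ)) [SFinite ν] (t : ℝ≥0) (x : ℝ) :
    gouKernel ν t x = ν.map (gouFlow x t) := by
  rw [gouKernel, Kernel.map_apply _ (measurable_gouFlow t), Kernel.prod_apply, Kernel.id_apply,
    Kernel.const_apply, Measure.dirac_prod, Measure.map_map (measurable_gouFlow t) (by fun_prop)]
  rfl

instance (ν : Measure (ℝ → ℝ)) [IsProbabilityMeasure ν] (t : ℝ≥0) :
    IsMarkovKernel (gouKernel ν t) :=
  Kernel.IsMarkovKernel.map _ (measurable_gouFlow t)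

variable [MeasurableSpace Ω] {P : Measure Ω} {Y : Ω → ℝ → ℝ}

lemma gouKernel_map_apply [IsProbabilityMeasure P] (hY : Measurable Y) (t : ℝ≥0) (x : ℝ) :
    gouKernel (P.map Y) t x = P.map fun ω => gouFlow x t (Y ω) := by
  rw [gouKernel_apply, Measure.map_map (measurable_gouFlow_right x t) hY]
  rfl

namespace IsTwoSidedLevy

lemma map_futurePath_apply [IsProbabilityMeasure P] (hY : IsTwoSidedLevy Y P) (s : ℝ) (t : ℝ≥0)
    (x : ℝ) {B : Set ℝ} (hB : MeasurableSet B) :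
    P.map (fun ω => futurePath (shiftIncr s (Y ω))) {u | gouFlow x t u ∈ B} =
      gouKernel (P.map Y) t x B := by
  have hm : Measurable fun ω => futurePath (shiftIncr s (Y ω)) :=
    measurable_futurePath.comp ((measurable_shiftIncr s).comp hY.measurable)
  have hm2 : Measurable fun ω => gouFlow x t (shiftIncr s (Y ω)) :=
    (measurable_gouFlow_right x t).comp ((measurable_shiftIncr s).comp hY.measurable)
  have hlaw : P.map (fun ω => gouFlow x t (Y ω)) =
      P.map fun ω => gouFlow x t (shiftIncr s (Y ω)) :=
    ((hY.stationary s).comp (measurable_gouFlow_right x t)).map_eq.symm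
  change P.map _ (gouFlow x t ⁻¹' B) = _
  rw [Measure.map_apply hm (measurable_gouFlow_right x t hB), gouKernel_map_apply hY.measurable,
    hlaw, Measure.map_apply hm2 hB]
  congr 1
  ext ω
  simp only [mem_preimage]
  rw [((hY.cadlag ω).isRightCts.increments s).gouFlow_futurePath x t.coe_nonneg]

/-- The Markov property of the flow at time `s`, tested on events of the past. -/
lemma measure_past_inter_gouFlow [IsProbabilityMeasure P] (hY : IsTwoSidedLevy Y P) (s : ℝ)
    (t : ℝ≥0) {g : (ℝ → ℝ) → ℝ} (hg : Measurable g) {C : Set (ℝ → ℝ)} (hC : MeasurableSet C)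
    {B : Set ℝ} (hB : MeasurableSet B) :
    P ((fun ω => pastPath (shiftIncr s (Y ω))) ⁻¹' C ∩
        {ω | gouFlow (g (pastPath (shiftIncr s (Y ω)))) t (shiftIncr s (Y ω)) ∈ B}) =
      ∫⁻ ω in (fun ω => pastPath (shiftIncr s (Y ω))) ⁻¹' C,
        gouKernel (P.map Y) t (g (pastPath (shiftIncr s (Y ω)))) B ∂P := by
  set Z : Ω → ℝ → ℝ := fun ω => pastPath (shiftIncr s (Y ω)) with hZ
  set U : Ω → ℝ → ℝ := fun ω => futurePath (shiftIncr s (Y ω)) with hU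
  have hZm : Measurable Z := measurable_pastPath.comp ((measurable_shiftIncr s).comp hY.measurable)
  have hUm : Measurable U := measurable_futurePath.comp ((measurable_shiftIncr s).comp hY.measurable)
  have hF : Measurable fun p : (ℝ → ℝ) × (ℝ → ℝ) => gouFlow (g p.1) t p.2 := by
    have h : Measurable fun p : (ℝ → ℝ) × (ℝ → ℝ) => (g p.1, p.2) :=
      (hg.comp measurable_fst).prodMk measurable_snd
    have h2 := (measurable_gouFlow t).comp h
    exact h2
  set D : Set ((ℝ → ℝ) × (ℝ → ℝ)) := {p | p.1 ∈ C ∧ gouFlow (g p.1) t p.2 ∈ B} with hD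
  have hDm : MeasurableSet D := (measurable_fst hC).inter (hF hB)
  have h1 : Z ⁻¹' C ∩ {ω | gouFlow (g (Z ω)) t (shiftIncr s (Y ω)) ∈ B} =
      (fun ω => (Z ω, U ω)) ⁻¹' D := by
    ext ω
    simp only [mem_inter_iff, mem_preimage, mem_ofPred_eq, hD, hU]
    rw [((hY.cadlag ω).isRightCts.increments s).gouFlow_futurePath _ t.coe_nonneg]
  -- By independence the law of (past, future) is a product; for a frozen past, the slice of `D` has
  -- the mass given by the kernel.
  rw [h1, ← Measure.map_apply (hZm.prodMk hUm) hDm,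
    (hY.indepFun_past_future s).map_prod_eq_prod_map_map hZm.aemeasurable hUm.aemeasurable,
    Measure.prod_apply hDm]
  have hk : Measurable fun z => gouKernel (P.map Y) t (g z) B :=
    (Kernel.measurable_coe _ hB).comp hg
  rw [← setLIntegral_map hC hk hZm, ← lintegral_indicator hC]
  refine lintegral_congr fun z => ?_
  by_cases hz : z ∈ C
  · rw [indicator_of_mem hz, ← hY.map_futurePath_apply s t (g z) hB]
    congr 1
    ext u
    simp [hD, hz]
  · rw [indicator_of_notMem hz]
    have : Prod.mk z ⁻¹' D = ∅ := by
      ext u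
      simp [hD, hz]
    rw [this, measure_empty]

lemma gouKernel_zero [IsProbabilityMeasure P] (hY : IsTwoSidedLevy Y P) :
    gouKernel (P.map Y) 0 = Kernel.id := by
  ext1 x
  rw [gouKernel_map_apply hY.measurable, Kernel.id_apply]
  have h : (fun ω => gouFlow x ((0 : ℝ≥0) : ℝ) (Y ω)) =ᵐ[P] fun _ => x := by
    filter_upwards [hY.zero] with ω hω
    rw [(hY.cadlag ω).isRightCts.gouFlow_eq]
    simp [hω]
  rw [Measure.map_congr h, Measure.map_const, measure_univ, one_smul]

/-- Chapman–Kolmogorov: the cocycle identity combined with the Markov property at time s, tested on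
the trivial past event. -/
lemma gouKernel_add [IsProbabilityMeasure P] (hY : IsTwoSidedLevy Y P) (s t : ℝ≥0) :
    gouKernel (P.map Y) (s + t) = gouKernel (P.map Y) t ∘ₖ gouKernel (P.map Y) s := by
  ext x B hB
  have hg : Measurable fun z => gouFlow x s (shiftIncr (-s) z) := by
    have h := (measurable_gouFlow_right x s).comp (measurable_shiftIncr (-s))
    exact h
  have h := hY.measure_past_inter_gouFlow s t hg MeasurableSet.univ hB
  rw [preimage_univ, univ_inter, setLIntegral_univ] at h
  have h0 : ∀ᵐ ω ∂P, gouFlow x s (shiftIncr (-s) (pastPath (shiftIncr s (Y ω)))) =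
      gouFlow x s (Y ω) := by
    filter_upwards [hY.zero] with ω hω
    exact ((hY.cadlag ω).isRightCts.gouFlow_eq_pastPath hω x s.coe_nonneg).symm
  have hmx : ∀ r : ℝ, Measurable fun ω => gouFlow x r (Y ω) := fun r =>
    (measurable_gouFlow_right x r).comp hY.measurable
  rw [Kernel.comp_apply' _ _ _ hB, gouKernel_map_apply hY.measurable s,
    lintegral_map (Kernel.measurable_coe _ hB) (hmx s),
    gouKernel_map_apply hY.measurable,
    Measure.map_apply (hmx _) hB]
  calc P ((fun ω => gouFlow x ((s + t : ℝ≥0) : ℝ) (Y ω)) ⁻¹' B)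
      = P {ω | gouFlow (gouFlow x s (shiftIncr (-s) (pastPath (shiftIncr s (Y ω))))) t
          (shiftIncr s (Y ω)) ∈ B} := by
        refine measure_congr ?_
        filter_upwards [h0] with ω hω
        refine propext ?_
        change gouFlow x ((s + t : ℝ≥0) : ℝ) (Y ω) ∈ B ↔ gouFlow _ _ _ ∈ B
        rw [hω, NNReal.coe_add, (hY.cadlag ω).gouFlow_add]
    _ = ∫⁻ ω, gouKernel (P.map Y) t (gouFlow x s (Y ω)) B ∂P := by
        rw [h]
        refine lintegral_congr_ae (h0.mono fun ω hω => ?_)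
        simp only [hω]

end IsTwoSidedLevy

end Flow

/-! ### Feller property of the semigroup, Markov property and càdlàg paths of the stationary
process. -/

section Feller

/-- An affine map near the identity moves points of a bounded interval little, so uniform continuity
applies there; far out both values of f are small. -/
lemma exists_dilation_close (f : C₀(ℝ, ℝ)) {ε : ℝ} (hε : 0 < ε) :
    ∃ δ > 0, ∀ a b : ℝ, |a - 1| < δ → |b| < δ → ∀ x, |f (a * (b + x)) - f x| ≤ ε := by
  have huc : UniformContinuous f := ZeroAtInftyContinuousMap.uniformContinuous f
  obtain ⟨δ₁, hδ₁, h1⟩ := Metric.uniformContinuous_iff.1 huc ε hε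
  obtain ⟨R, hR⟩ : ∃ R : ℝ, ∀ x, R ≤ |x| → |f x| < ε / 2 := by
    have h := (Metric.tendsto_nhds.1 f.zero_at_infty' (ε / 2) (half_pos hε))
    rw [← Metric.cobounded_eq_cocompact, ← comap_norm_atTop, eventually_comap, eventually_atTop] at h
    obtain ⟨R, hR⟩ := h
    refine ⟨R, fun x hx => ?_⟩
    have := hR |x| hx x rfl
    rwa [dist_zero_right] at this
  -- With `a ≥ 1/2` and `|b| ≤ 1/2`, `|x| > K` forces `|a (b + x)| ≥ R`. For `|x| ≤ K` the
  -- displacement is at most `|a - 1| K + 2 |b|`, whence the `K + 2` in δ.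
  set K : ℝ := 2 * |R| + 2 with hK
  have hK2 : 2 ≤ K := by
    have := abs_nonneg R
    linarith
  refine ⟨min (1 / 2) (δ₁ / (K + 2)), by positivity, fun a b ha hb x => ?_⟩
  have ha1 := abs_lt.1 (ha.trans_le (min_le_left _ _))
  have hb1 := (hb.trans_le (min_le_left _ _))
  have ha2 := (ha.trans_le (min_le_right _ _))
  have hb2 := (hb.trans_le (min_le_right _ _))
  rw [lt_div_iff₀ (by linarith)] at ha2 hb2
  rcases le_or_gt |x| K with hx | hx
  · have hd : dist (a * (b + x)) x < δ₁ := by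
      rw [Real.dist_eq, show a * (b + x) - x = (a - 1) * x + a * b by ring]
      refine (abs_add_le _ _).trans_lt ?_
      rw [abs_mul, abs_mul]
      have h2 : |a| ≤ 2 := abs_le.2 ⟨by linarith, by linarith⟩
      have h3 : |a - 1| * |x| ≤ |a - 1| * K := mul_le_mul_of_nonneg_left hx (abs_nonneg _)
      have h4 : |a| * |b| ≤ 2 * |b| := mul_le_mul_of_nonneg_right h2 (abs_nonneg _)
      set c := max |a - 1| |b|
      have h5 : c * (K + 2) < δ₁ := by
        rcases max_choice |a - 1| |b| with h | h <;> simp only [c, h] <;> assumption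
      have h6 : |a - 1| ≤ c := le_max_left _ _
      have h7 : |b| ≤ c := le_max_right _ _
      nlinarith
    exact (h1 hd).le
  · have h2 : R ≤ |x| := by
      have := le_abs_self R
      have := abs_nonneg R
      linarith
    have h3 : R ≤ |a * (b + x)| := by
      rw [abs_mul, abs_of_pos (by linarith : 0 < a)]
      have h4 : |x| ≤ |b + x| + |b| := by
        have := abs_sub (b + x) b
        rwa [add_sub_cancel_left] at this
      have := le_abs_self R
      have h5 : 2 * |R| + 1 ≤ |b + x| := by linarith
      have h6 := abs_nonneg (b + x)
      nlinarith
    have h4 := abs_sub (f (a * (b + x))) (f x)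
    linarith [hR _ h2, hR _ h3]

variable [MeasurableSpace Ω] {P : Measure Ω} {Y : Ω → ℝ → ℝ}

namespace IsTwoSidedLevy

lemma integral_gouKernel [IsProbabilityMeasure P] (hY : IsTwoSidedLevy Y P) (f : C₀(ℝ, ℝ))
    (t : ℝ≥0) (x : ℝ) :
    ∫ y, f y ∂(gouKernel (P.map Y) t x) = ∫ ω, f (gouFlow x t (Y ω)) ∂P := by
  have hm : Measurable fun ω => gouFlow x t (Y ω) :=
    (measurable_gouFlow_right x t).comp hY.measurable
  rw [gouKernel_map_apply hY.measurable, integral_map hm.aemeasurable]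
  exact f.continuous.aestronglyMeasurable

lemma aestronglyMeasurable_comp_gouFlow (hY : IsTwoSidedLevy Y P) (f : C₀(ℝ, ℝ)) (t x : ℝ) :
    AEStronglyMeasurable (fun ω => f (gouFlow x t (Y ω))) P :=
  (f.continuous.measurable.comp
    ((measurable_gouFlow_right x t).comp hY.measurable)).aestronglyMeasurable

lemma exists_zeroAtInfty_integral_gouKernel [IsProbabilityMeasure P] (hY : IsTwoSidedLevy Y P)
    (t : ℝ≥0) (f : C₀(ℝ, ℝ)) :
    ∃ g : C₀(ℝ, ℝ), ∀ x, g x = ∫ y, f y ∂(gouKernel (P.map Y) t x) := by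
  simp_rw [hY.integral_gouKernel f]
  have hb : ∀ y, ‖f y‖ ≤ ‖f‖ := fun y => f.toBCF.norm_coe_le_norm y
  refine ⟨⟨⟨fun x => ∫ ω, f (gouFlow x t (Y ω)) ∂P, ?_⟩, ?_⟩, fun x => rfl⟩
  · refine continuous_of_dominated (bound := fun _ => ‖f‖)
      (fun x => hY.aestronglyMeasurable_comp_gouFlow f t x)
      (fun x => Eventually.of_forall fun ω => hb _) (integrable_const _)
      (Eventually.of_forall fun ω => ?_)
    refine f.continuous.comp ?_
    unfold gouFlow
    fun_prop
  · have hcg : (cocompact ℝ).IsCountablyGenerated := by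
      rw [← Metric.cobounded_eq_cocompact, ← comap_norm_atTop]
      infer_instance
    have h : Tendsto (fun x => ∫ ω, f (gouFlow x t (Y ω)) ∂P) (cocompact ℝ)
        (𝓝 (∫ _, (0 : ℝ) ∂P)) := by
      refine tendsto_integral_filter_of_dominated_convergence (fun _ => ‖f‖)
        (Eventually.of_forall fun x => hY.aestronglyMeasurable_comp_gouFlow f t x)
        (Eventually.of_forall fun x => Eventually.of_forall fun ω => hb _) (integrable_const _)
        (Eventually.of_forall fun ω => ?_)
      refine f.zero_at_infty'.comp ?_
      -- For a fixed path the flow is an affine homeomorphism of the line, so it tends to infinity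
      -- with x.
      exact ((Homeomorph.addLeft (∫ s in (0 : ℝ)..t, Real.exp (regPath (Y ω) s))).trans
        (Homeomorph.mulLeft₀ (Real.exp (-regPath (Y ω) t)) (Real.exp_pos _).ne')
        ).isClosedEmbedding.tendsto_cocompact
    simpa using h

lemma tendstoUniformly_integral_gouKernel [IsProbabilityMeasure P] (hY : IsTwoSidedLevy Y P)
    (f : C₀(ℝ, ℝ)) :
    TendstoUniformly (fun (t : ℝ≥0) (x : ℝ) => ∫ y, f y ∂(gouKernel (P.map Y) t x)) f
      (𝓝[>] 0) := by
  simp_rw [hY.integral_gouKernel f]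
  have hb : ∀ y, |f y| ≤ ‖f‖ := fun y => f.toBCF.norm_coe_le_norm y
  rw [Metric.tendstoUniformly_iff]
  intro ε hε
  obtain ⟨δ, hδ, hf⟩ := exists_dilation_close f (half_pos hε)
  set a : ℝ≥0 → Ω → ℝ := fun t ω => Real.exp (-regPath (Y ω) t) with ha
  set b : ℝ≥0 → Ω → ℝ := fun t ω => ∫ s in (0 : ℝ)..t, Real.exp (regPath (Y ω) s) with hb'
  have hflow : ∀ x (t : ℝ≥0) ω, gouFlow x t (Y ω) = a t ω * (b t ω + x) := fun _ _ _ => rfl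
  have ham : ∀ t, Measurable (a t) := fun t =>
    (hY.measurable.regPath measurable_const).neg.exp
  have hbm : ∀ t, Measurable (b t) := fun t => by
    have h1 := (measurable_setIntegral_exp_regPath (Ioc 0 (t : ℝ))).comp hY.measurable
    have h2 : b t = fun ω => ∫ s in Ioc 0 (t : ℝ), Real.exp (regPath (Y ω) s) :=
      funext fun ω => intervalIntegral.integral_of_le t.coe_nonneg
    rw [h2]
    exact h1
  -- The bad event does not involve x; this is what makes the convergence uniform.
  set bad : ℝ≥0 → Set Ω := fun t => {ω | |a t ω - 1| < δ ∧ |b t ω| < δ}ᶜ with hbad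
  have hbadm : ∀ t, MeasurableSet (bad t) := fun t =>
    ((measurableSet_lt ((ham t).sub_const 1).abs measurable_const).inter
      (measurableSet_lt (hbm t).abs measurable_const)).compl
  have hlim : Tendsto (fun t => P.real (bad t)) (𝓝[>] 0) (𝓝 0) := by
    have h : Tendsto (fun t => ∫ ω, (bad t).indicator (fun _ => (1 : ℝ)) ω ∂P) (𝓝[>] 0)
        (𝓝 (∫ _, (0 : ℝ) ∂P)) := by
      refine tendsto_integral_filter_of_dominated_convergence (fun _ => 1)
        (Eventually.of_forall fun t => (measurable_const.indicator (hbadm t)).aestronglyMeasurable)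
        (Eventually.of_forall fun t => Eventually.of_forall fun ω =>
          (norm_indicator_le_norm_self _ _).trans (by simp)) (integrable_const _) ?_
      filter_upwards [hY.zero] with ω hω
      have hc := hY.cadlag ω
      have hcoe : Tendsto (fun t : ℝ≥0 => (t : ℝ)) (𝓝[>] 0) (𝓝[≥] 0) :=
        tendsto_nhdsWithin_iff.2 ⟨(NNReal.continuous_coe.tendsto' 0 0 rfl).mono_left
          nhdsWithin_le_nhds, Eventually.of_forall fun t => t.coe_nonneg⟩
      have h1 : Tendsto (fun t => |a t ω - 1|) (𝓝[>] 0) (𝓝 0) := by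
        have h := (Real.continuous_exp.tendsto _).comp ((hc 0).1.tendsto.comp hcoe).neg
        rw [hω] at h
        have h2 := (h.sub_const 1).abs
        simp only [ha, hc.isRightCts.regPath_eq]
        simpa using h2
      have h2 : Tendsto (fun t => |b t ω|) (𝓝[>] 0) (𝓝 0) := by
        have h := (intervalIntegral.continuous_primitive
          (fun c d => hc.intervalIntegrable_exp c d) 0).tendsto 0
        have h2 := (h.comp (hcoe.mono_right nhdsWithin_le_nhds)).abs
        simp only [hb', hc.isRightCts.regPath_eq]
        simpa using h2
      refine tendsto_const_nhds.congr' ?_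
      filter_upwards [h1.eventually (gt_mem_nhds hδ), h2.eventually (gt_mem_nhds hδ)] with t h1 h2
      rw [indicator_of_notMem]
      simp [hbad, h1, h2]
    simp_rw [integral_indicator_const _ (hbadm _)] at h
    simpa using h
  have hlim2 : Tendsto (fun t => ε / 2 + 2 * ‖f‖ * P.real (bad t)) (𝓝[>] 0) (𝓝 (ε / 2)) := by
    simpa using (hlim.const_mul (2 * ‖f‖)).const_add (ε / 2)
  filter_upwards [hlim2.eventually (gt_mem_nhds (half_lt_self hε))] with t ht x
  have hint : Integrable (fun ω => f (gouFlow x t (Y ω))) P :=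
    (integrable_const ‖f‖).mono' (hY.aestronglyMeasurable_comp_gouFlow f t x)
      (Eventually.of_forall fun ω => hb _)
  have h1 : ∫ ω, f (gouFlow x t (Y ω)) ∂P - f x = ∫ ω, (f (gouFlow x t (Y ω)) - f x) ∂P := by
    rw [integral_sub hint (integrable_const _)]
    simp
  rw [dist_comm, Real.dist_eq, h1]
  refine lt_of_le_of_lt ?_ ht
  have hgi : Integrable (fun ω => ε / 2 + (bad t).indicator (fun _ => 2 * ‖f‖) ω) P :=
    (integrable_const _).add ((integrable_const _).indicator (hbadm t))
  have h2 : ε / 2 + 2 * ‖f‖ * P.real (bad t) =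
      ∫ ω, (ε / 2 + (bad t).indicator (fun _ => 2 * ‖f‖) ω) ∂P := by
    rw [integral_add (integrable_const _) ((integrable_const _).indicator (hbadm t)),
      integral_indicator_const _ (hbadm t)]
    simp [mul_comm]
  rw [h2, ← Real.norm_eq_abs]
  refine norm_integral_le_of_norm_le hgi (Eventually.of_forall fun ω => ?_)
  rw [Real.norm_eq_abs, hflow]
  by_cases hω : ω ∈ bad t
  · rw [indicator_of_mem hω]
    refine (abs_sub _ _).trans ?_
    linarith [hb (a t ω * (b t ω + x)), hb x]
  · rw [indicator_of_notMem hω, add_zero]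
    simp only [hbad, mem_compl_iff, not_not, mem_ofPred_eq] at hω
    exact hf _ _ hω.1 hω.2 x

lemma isFellerSemigroup_gouKernel [IsProbabilityMeasure P] (hY : IsTwoSidedLevy Y P) :
    IsFellerSemigroup (gouKernel (P.map Y)) where
  markov t := by
    have : IsProbabilityMeasure (P.map Y) :=
      Measure.isProbabilityMeasure_map hY.measurable.aemeasurable
    infer_instance
  zero := hY.gouKernel_zero
  add := hY.gouKernel_add
  mapsTo := hY.exists_zeroAtInfty_integral_gouKernel
  strongCont := hY.tendstoUniformly_integral_gouKernel

/-- The values up to time s are functions of the past increments at s, so the process's own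
filtration is contained in theirs. Testing on the larger σ-algebra suffices, since the candidate
depends only on `X s`. -/
lemma isMarkovProcess_gouPath [IsProbabilityMeasure P] (hY : IsTwoSidedLevy Y P)
    (hi : ∀ᵐ ω ∂P, ∀ t, IntegrableOn (fun s => Real.exp (Y ω s)) (Iic t)) :
    IsMarkovProcess (gouKernel (P.map Y)) (fun t ω => gouPath (Y ω) t) P where
  measurable t := (measurable_gouPath_apply t).comp hY.measurable
  markov s t B hB := by
    have : IsProbabilityMeasure (P.map Y) :=
      Measure.isProbabilityMeasure_map hY.measurable.aemeasurable
    set X : ℝ → Ω → ℝ := fun t ω => gouPath (Y ω) t with hX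
    have hXm : ∀ t, Measurable (X t) := fun t => (measurable_gouPath_apply t).comp hY.measurable
    set Z : Ω → ℝ → ℝ := fun ω => pastPath (shiftIncr s (Y ω)) with hZ
    have hXZ : ∀ u ≤ s, X u = (fun z => gouPath z (u - s)) ∘ Z := fun u hu => by
      funext ω
      have hr := (hY.cadlag ω).isRightCts
      simp only [hX, hZ, Function.comp_apply]
      rw [(hr.increments s).gouPath_pastPath (by linarith), hr.gouPath_shiftIncr, add_sub_cancel]
    have hmle : (⨆ u : Iic s, MeasurableSpace.comap (X u) Real.measurableSpace) ≤ ‹MeasurableSpace Ω› :=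
      iSup_le fun u => (hXm u).comap_le
    have hmZ : (⨆ u : Iic s, MeasurableSpace.comap (X u) Real.measurableSpace) ≤
        MeasurableSpace.comap Z inferInstance := iSup_le fun u => by
      rw [hXZ u u.2, ← MeasurableSpace.comap_comp]
      exact MeasurableSpace.comap_mono (measurable_gouPath_apply _).comap_le
    have hXsm : Measurable[(⨆ u : Iic s, MeasurableSpace.comap (X u) Real.measurableSpace)] (X s) := by
      have h := le_iSup (fun u : Iic s => MeasurableSpace.comap (X u) Real.measurableSpace)
        ⟨s, mem_Iic.2 le_rfl⟩
      exact (comap_measurable (X s)).mono h le_rfl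
    have hk : Measurable fun x => (gouKernel (P.map Y) t x).real B :=
      (Kernel.measurable_coe _ hB).ennreal_toReal
    have hEm : MeasurableSet (X (s + t) ⁻¹' B) := hXm _ hB
    have hkb : ∀ ω, ‖(gouKernel (P.map Y) t (X s ω)).real B‖ ≤ 1 := fun ω => by
      rw [Real.norm_of_nonneg measureReal_nonneg]
      exact measureReal_le_one
    symm
    refine ae_eq_condExp_of_forall_setIntegral_eq hmle
      ((integrable_const (1 : ℝ)).indicator hEm) (fun S _ _ => ?_) (fun S hS _ => ?_)
      (hk.comp hXsm).stronglyMeasurable.aestronglyMeasurable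
    · exact ((integrable_const (1 : ℝ)).mono' ((hk.comp (hXm s)).aestronglyMeasurable)
        (Eventually.of_forall hkb)).integrableOn
    · obtain ⟨C, hC, rfl⟩ := hmZ S hS
      have hZm : Measurable Z :=
        measurable_pastPath.comp ((measurable_shiftIncr s).comp hY.measurable)
      have h := hY.measure_past_inter_gouFlow s t (measurable_gouPath_apply 0) hC hB
      have hXs : ∀ ω, gouPath (pastPath (shiftIncr s (Y ω))) 0 = X s ω := fun ω => by
        rw [hXZ s le_rfl, sub_self]
        rfl
      simp_rw [hXs] at h
      have h2 : P (Z ⁻¹' C ∩ X (s + t) ⁻¹' B) =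
          ∫⁻ ω in Z ⁻¹' C, gouKernel (P.map Y) t (X s ω) B ∂P := by
        rw [← h]
        refine measure_congr ?_
        filter_upwards [hi] with ω hω
        refine propext (and_congr Iff.rfl ?_)
        change gouPath (Y ω) (s + t) ∈ B ↔ gouFlow (gouPath (Y ω) s) t (shiftIncr s (Y ω)) ∈ B
        rw [(hY.cadlag ω).gouPath_add hω]
      rw [setIntegral_indicator hEm, setIntegral_const, smul_eq_mul, mul_one, measureReal_def, h2]
      exact integral_toReal ((Kernel.measurable_coe _ hB).comp (hXm s)).aemeasurable
        (Eventually.of_forall fun ω => measure_lt_top _ _)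

lemma ae_isCadlag_gouPath (hY : IsTwoSidedLevy Y P)
    (hi : ∀ᵐ ω ∂P, ∀ t, IntegrableOn (fun s => Real.exp (Y ω s)) (Iic t)) :
    ∀ᵐ ω ∂P, IsCadlag fun t => gouPath (Y ω) t := by
  filter_upwards [hi] with ω hω
  have hc := hY.cadlag ω
  simp_rw [hc.isRightCts.gouPath_eq]
  refine (hc.comp_continuous (g := fun x => Real.exp (-x)) (by fun_prop)).mul
    (Continuous.isCadlag ?_)
  have h : ∀ t, ∫ s in Iic t, Real.exp (Y ω s) =
      (∫ s in Iic 0, Real.exp (Y ω s)) + ∫ s in (0 : ℝ)..t, Real.exp (Y ω s) := fun t => by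
    rw [← intervalIntegral.integral_Iic_sub_Iic (hω 0) (hω t), add_sub_cancel]
  rw [funext h]
  exact continuous_const.add
    (intervalIntegral.continuous_primitive (fun c d => hc.intervalIntegrable_exp c d) 0)

end IsTwoSidedLevy

end Feller

/-! ### Continuous-time ergodic theorem and conclusion. -/

section ErgodicAverages

/-- Cesàro averages along the integers determine the continuous-time averages. -/
lemma tendsto_average_of_nat {h : ℝ → ℝ} (hi : ∀ a b, IntervalIntegrable h volume a b) {c d : ℝ}
    (hc : Tendsto (fun n : ℕ => (n : ℝ)⁻¹ * ∫ s in (0 : ℝ)..n, h s) atTop (𝓝 c))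
    (hd : Tendsto (fun n : ℕ => (n : ℝ)⁻¹ * ∫ s in (0 : ℝ)..n, |h s|) atTop (𝓝 d)) :
    Tendsto (fun t : ℝ => t⁻¹ * ∫ s in (0 : ℝ)..t, h s) atTop (𝓝 c) := by
  set H : ℕ → ℝ := fun n => ∫ s in (0 : ℝ)..n, |h s| with hH
  -- Convergence of the averages of `|h|` makes its integral over the n-th unit interval o(n); this
  -- controls the remainder between `⌊t⌋₊` and t.
  have hgap : Tendsto (fun n : ℕ => (n : ℝ)⁻¹ * (H (n + 1) - H n)) atTop (𝓝 0) := by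
    have h1 : Tendsto (fun n : ℕ => ((n : ℝ)⁻¹ * ((n + 1 : ℕ) : ℝ)) *
        (((n + 1 : ℕ) : ℝ)⁻¹ * H (n + 1)) - (n : ℝ)⁻¹ * H n) atTop (𝓝 (1 * d - d)) := by
      refine (Tendsto.mul ?_ (hd.comp (tendsto_add_atTop_nat 1))).sub hd
      have h2 : Tendsto (fun n : ℕ => 1 + (n : ℝ)⁻¹) atTop (𝓝 (1 + 0)) :=
        tendsto_const_nhds.add tendsto_inv_atTop_nhds_zero_nat
      rw [add_zero] at h2
      refine h2.congr' ?_
      filter_upwards [eventually_gt_atTop 0] with n hn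
      have : (n : ℝ) ≠ 0 := by positivity
      push_cast
      field_simp
    rw [one_mul, sub_self] at h1
    refine h1.congr fun n => ?_
    have : ((n + 1 : ℕ) : ℝ) ≠ 0 := by positivity
    rw [mul_assoc, mul_inv_cancel_left₀ this, mul_sub]
  have hfl : Tendsto (fun t : ℝ => ⌊t⌋₊) atTop atTop := tendsto_nat_floor_atTop
  have hratio : Tendsto (fun t : ℝ => (⌊t⌋₊ : ℝ) / t) atTop (𝓝 1) := tendsto_nat_floor_div_atTop
  have hmain : Tendsto (fun t : ℝ => (⌊t⌋₊ : ℝ) / t * ((⌊t⌋₊ : ℝ)⁻¹ * ∫ s in (0 : ℝ)..⌊t⌋₊, h s))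
      atTop (𝓝 (1 * c)) := hratio.mul (hc.comp hfl)
  have hrem : Tendsto (fun t : ℝ => t⁻¹ * ∫ s in (⌊t⌋₊ : ℝ)..t, h s) atTop (𝓝 0) := by
    have h1 := hratio.mul (hgap.comp hfl)
    rw [mul_zero] at h1
    refine squeeze_zero_norm' ?_ h1
    filter_upwards [eventually_ge_atTop 1] with t ht
    have hn : (0 : ℝ) < ⌊t⌋₊ := by exact_mod_cast Nat.floor_pos.2 ht
    have hle : (⌊t⌋₊ : ℝ) ≤ t := Nat.floor_le (by linarith)
    have hlt : t ≤ (⌊t⌋₊ + 1 : ℕ) := by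
      push_cast
      exact (Nat.lt_floor_add_one t).le
    have hab : ∀ a b, IntervalIntegrable (fun s => |h s|) volume a b := fun a b => (hi a b).abs
    have e1 : H (⌊t⌋₊ + 1) - H ⌊t⌋₊ = ∫ s in (⌊t⌋₊ : ℝ)..(⌊t⌋₊ + 1 : ℕ), |h s| :=
      intervalIntegral.integral_interval_sub_left (hab _ _) (hab _ _)
    have e2 : |∫ s in (⌊t⌋₊ : ℝ)..t, h s| ≤ H (⌊t⌋₊ + 1) - H ⌊t⌋₊ := by
      rw [e1]
      refine (intervalIntegral.abs_integral_le_integral_abs hle).trans ?_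
      exact intervalIntegral.integral_mono_interval le_rfl hle hlt
        (Eventually.of_forall fun s => abs_nonneg _) (hab _ _)
    rw [Function.comp_apply, norm_mul, Real.norm_eq_abs, Real.norm_eq_abs,
      abs_of_pos (by positivity : 0 < t⁻¹), div_mul_eq_mul_div, mul_inv_cancel_left₀ hn.ne',
      div_eq_inv_mul]
    gcongr
  have := hmain.add hrem
  rw [one_mul, add_zero] at this
  refine this.congr' ?_
  filter_upwards [eventually_ge_atTop 1] with t ht
  have hn : (0 : ℝ) < ⌊t⌋₊ := by exact_mod_cast Nat.floor_pos.2 ht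
  rw [div_mul_eq_mul_div, mul_inv_cancel_left₀ hn.ne', div_eq_inv_mul, ← mul_add,
    intervalIntegral.integral_add_adjacent_intervals (hi _ _) (hi _ _)]

variable [MeasurableSpace Ω] {P : Measure Ω} {Y : Ω → ℝ → ℝ}

lemma IsRightCts.gouPath_iterate {w : ℝ → ℝ} (hw : IsRightCts w) (h : ℝ) (k : ℕ) (t : ℝ) :
    gouPath ((shiftIncr h)^[k] w) t = gouPath w (k * h + t) := by
  induction k generalizing t with
  | zero => simp
  | succ k ih =>
    rw [Function.iterate_succ_apply', (hw.iterate h k).gouPath_shiftIncr, ih]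
    congr 1
    push_cast
    ring

namespace IsTwoSidedLevy

lemma map_gouPath (hY : IsTwoSidedLevy Y P) (t : ℝ) :
    P.map (fun ω => gouPath (Y ω) t) = P.map fun ω => gouPath (Y ω) 0 := by
  have h := ((hY.isStationaryProcess_gouPath t).comp (measurable_pi_apply (0 : ℝ))).map_eq
  rw [← zero_add t]
  exact h

lemma integrable_comp_gouPath [IsProbabilityMeasure P] (hY : IsTwoSidedLevy Y P) {g : ℝ → ℝ}
    (hgm : Measurable g) (hg : Integrable g (P.map fun ω => gouPath (Y ω) 0)) (a b : ℝ) :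
    Integrable (fun p : (ℝ → ℝ) × ℝ => g (gouPath p.1 p.2))
      ((P.map Y).prod (volume.restrict (Ioc a b))) := by
  have : IsProbabilityMeasure (P.map Y) := Measure.isProbabilityMeasure_map hY.measurable.aemeasurable
  have hmap : ∀ s, (P.map Y).map (fun w => gouPath w s) = P.map fun ω => gouPath (Y ω) 0 := by
    intro s
    rw [Measure.map_map (measurable_gouPath_apply s) hY.measurable, ← hY.map_gouPath s]
    rfl
  have hm : Measurable fun p : (ℝ → ℝ) × ℝ => g (gouPath p.1 p.2) := hgm.comp measurable_gouPath
  rw [integrable_prod_iff' hm.aestronglyMeasurable]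
  constructor
  · refine Eventually.of_forall fun s => ?_
    have h := hg
    rw [← hmap s] at h
    exact h.comp_measurable (measurable_gouPath_apply s)
  · have h : ∀ s, ∫ w, ‖g (gouPath w s)‖ ∂(P.map Y) =
        ∫ x, ‖g x‖ ∂(P.map fun ω => gouPath (Y ω) 0) := by
      intro s
      rw [← hmap s, integral_map (measurable_gouPath_apply s).aemeasurable
        hgm.norm.aestronglyMeasurable]
    simp_rw [h]
    exact integrable_const _

lemma ae_intervalIntegrable_comp_gouPath [IsProbabilityMeasure P] (hY : IsTwoSidedLevy Y P)
    {g : ℝ → ℝ} (hgm : Measurable g) (hg : Integrable g (P.map fun ω => gouPath (Y ω) 0)) :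
    ∀ᵐ ω ∂P, ∀ a b, IntervalIntegrable (fun s => g (gouPath (Y ω) s)) volume a b := by
  have h : ∀ᵐ ω ∂P, ∀ n : ℕ, IntegrableOn (fun s => g (gouPath (Y ω) s)) (Ioc (-n) n) :=
    ae_all_iff.2 fun n => ae_of_ae_map hY.measurable.aemeasurable
      (hY.integrable_comp_gouPath hgm hg (-n) n).prod_right_ae
  filter_upwards [h] with ω hω a b
  obtain ⟨n, hn⟩ := exists_nat_gt (max |a| |b|)
  have ha := abs_lt.1 ((le_max_left _ _).trans_lt hn)
  have hb := abs_lt.1 ((le_max_right _ _).trans_lt hn)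
  rw [intervalIntegrable_iff]
  exact (hω n).mono_set (Ioc_subset_Ioc (le_min ha.1.le hb.1.le) (max_le ha.2.le hb.2.le))

/-- The Birkhoff sums, under the shift by 1, of the integral over `(0, 1]` are the integrals over
`(0, n]`; its mean is found by Fubini and stationarity. -/
lemma ae_tendsto_nat_average [IsProbabilityMeasure P] (hY : IsTwoSidedLevy Y P)
    {g : ℝ → ℝ} (hgm : Measurable g) (hg : Integrable g (P.map fun ω => gouPath (Y ω) 0)) :
    ∀ᵐ ω ∂P, Tendsto (fun n : ℕ => (n : ℝ)⁻¹ * ∫ s in (0 : ℝ)..n, g (gouPath (Y ω) s)) atTop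
      (𝓝 (∫ x, g x ∂(P.map fun ω => gouPath (Y ω) 0))) := by
  have : IsProbabilityMeasure (P.map Y) := Measure.isProbabilityMeasure_map hY.measurable.aemeasurable
  have hm : Measurable fun p : (ℝ → ℝ) × ℝ => g (gouPath p.1 p.2) := hgm.comp measurable_gouPath
  have hint := hY.integrable_comp_gouPath hgm hg 0 1
  set F : (ℝ → ℝ) → ℝ := fun w => ∫ s in Ioc 0 1, g (gouPath w s) with hF
  have hFm : Measurable F :=
    (hm.stronglyMeasurable.integral_prod_right' (ν := volume.restrict (Ioc 0 1))).measurable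
  have hFi : Integrable F (P.map Y) := hint.integral_prod_left
  have hmean : ∫ w, F w ∂(P.map Y) = ∫ x, g x ∂(P.map fun ω => gouPath (Y ω) 0) := by
    rw [hF, integral_integral_swap hint]
    have h : ∀ s, ∫ w, g (gouPath w s) ∂(P.map Y) =
        ∫ x, g x ∂(P.map fun ω => gouPath (Y ω) 0) := by
      intro s
      have hms : Measurable fun w : ℝ → ℝ => g (gouPath w s) :=
        hgm.comp (measurable_gouPath_apply s)
      have hms' : Measurable fun ω => gouPath (Y ω) s :=
        (measurable_gouPath_apply s).comp hY.measurable
      rw [← hY.map_gouPath s, integral_map hY.measurable.aemeasurable hms.aestronglyMeasurable,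
        integral_map hms'.aemeasurable hgm.aestronglyMeasurable]
    simp_rw [h]
    simp
  have hB := ae_of_ae_map hY.measurable.aemeasurable
    ((hY.ergodic one_pos).ae_tendsto_birkhoffAverage hFm hFi)
  filter_upwards [hB, hY.ae_intervalIntegrable_comp_gouPath hgm hg] with ω hω hωi
  rw [hmean] at hω
  refine hω.congr fun n => ?_
  rw [birkhoffAverage, smul_eq_mul, birkhoffSum]
  congr 1
  have hk : ∀ k : ℕ, F ((shiftIncr 1)^[k] (Y ω)) =
      ∫ s in (k : ℝ)..(k + 1 : ℕ), g (gouPath (Y ω) s) := by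
    intro k
    simp only [hF, (hY.cadlag ω).isRightCts.gouPath_iterate]
    rw [← intervalIntegral.integral_of_le zero_le_one,
      intervalIntegral.integral_comp_add_left (fun s => g (gouPath (Y ω) s))]
    simp
  simp_rw [hk]
  rw [intervalIntegral.sum_integral_adjacent_intervals fun k _ => hωi _ _, Nat.cast_zero]

lemma ae_ae_notMem_of_null [IsProbabilityMeasure P] (hY : IsTwoSidedLevy Y P) {N : Set ℝ}
    (hN : MeasurableSet N) (h0 : (P.map fun ω => gouPath (Y ω) 0) N = 0) :
    ∀ᵐ ω ∂P, ∀ᵐ s : ℝ, gouPath (Y ω) s ∉ N := by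
  have hm : Measurable fun p : ℝ × Ω => gouPath (Y p.2) p.1 := by
    have h : Measurable fun p : ℝ × Ω => (Y p.2, p.1) :=
      (hY.measurable.comp measurable_snd).prodMk measurable_fst
    have h2 := measurable_gouPath.comp h
    exact h2
  rw [← Measure.ae_ae_comm (p := fun s ω => gouPath (Y ω) s ∉ N) (hm hN).compl]
  refine Eventually.of_forall fun s => ?_
  have hms : Measurable fun ω => gouPath (Y ω) s := (measurable_gouPath_apply s).comp hY.measurable
  rw [← hY.map_gouPath s, Measure.map_apply hms hN] at h0
  exact measure_eq_zero_iff_ae_notMem.1 h0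

/-- The ergodic theorem for the stationary generalized Ornstein–Uhlenbeck process. -/
lemma ae_tendsto_average [IsProbabilityMeasure P] (hY : IsTwoSidedLevy Y P) {f : ℝ → ℝ}
    (hf : Integrable f (P.map fun ω => gouPath (Y ω) 0)) :
    ∀ᵐ ω ∂P, (∀ t, IntervalIntegrable (fun s => f (gouPath (Y ω) s)) volume 0 t) ∧
      Tendsto (fun t : ℝ => t⁻¹ * ∫ s in (0 : ℝ)..t, f (gouPath (Y ω) s)) atTop
        (𝓝 (∫ x, f x ∂(P.map fun ω => gouPath (Y ω) 0))) := by
  -- f is only almost everywhere measurable. Almost surely the process spends zero time where f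
  -- differs from g, so the time integrals agree.
  obtain ⟨g, hgm, hfg⟩ : ∃ g : ℝ → ℝ, Measurable g ∧ f =ᵐ[P.map fun ω => gouPath (Y ω) 0] g :=
    ⟨hf.1.mk f, hf.1.stronglyMeasurable_mk.measurable, hf.1.ae_eq_mk⟩
  have hg := hf.congr hfg
  obtain ⟨N, hsub, hN, hN0⟩ := exists_measurable_superset_of_null (ae_iff.1 hfg)
  filter_upwards [hY.ae_ae_notMem_of_null hN hN0, hY.ae_intervalIntegrable_comp_gouPath hgm hg,
    hY.ae_tendsto_nat_average hgm hg, hY.ae_tendsto_nat_average hgm.abs hg.abs]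
    with ω hω hi h1 h2
  have hae : ∀ᵐ s : ℝ, f (gouPath (Y ω) s) = g (gouPath (Y ω) s) := by
    filter_upwards [hω] with s hs
    by_contra hne
    exact hs (hsub hne)
  constructor
  · exact fun t => (hi 0 t).congr_ae (ae_restrict_of_ae (hae.mono fun s hs => hs.symm))
  · rw [integral_congr_ae hfg]
    refine (tendsto_average_of_nat hi h1 h2).congr fun t => ?_
    rw [intervalIntegral.integral_congr_ae (hae.mono fun s hs _ => hs)]

end IsTwoSidedLevy

lemma twoSidedGOU_eq_gouPath {ξ η : ℝ≥0 → Ω → ℝ} (hξ : IsLevyProcess ξ P)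
    (hη : IsIndepDual ξ η P) :
    twoSidedGOU ξ η = fun t ω => gouPath (fun s => twoSided ξ η s ω) t := by
  funext t ω
  rw [(isCadlag_twoSided (hξ.cadlag ω) (hη.cadlag ω)).isRightCts.gouPath_eq, twoSidedGOU]

lemma gouFlow_twoSided {ξ η : ℝ≥0 → Ω → ℝ} (hξ : IsLevyProcess ξ P)
    (hη : IsIndepDual ξ η P) (x : ℝ) (t : ℝ≥0) :
    (fun ω => gouFlow x t fun s => twoSided ξ η s ω) = gouFrom ξ x t := by
  funext ω
  rw [(isCadlag_twoSided (hξ.cadlag ω) (hη.cadlag ω)).isRightCts.gouFlow_eq, gouFrom,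
    twoSided_of_nonneg _ _ t.coe_nonneg, Real.toNNReal_coe]
  congr 2
  refine intervalIntegral.integral_congr fun s hs => ?_
  rw [uIcc_of_le t.coe_nonneg] at hs
  rw [twoSided_of_nonneg _ _ hs.1]

end ErgodicAverages

theorem theorem2p1 {Ω : Type*} [MeasurableSpace Ω] (P : Measure Ω) [IsProbabilityMeasure P]
    (ξ η : ℝ≥0 → Ω → ℝ) (hξ : IsLevyProcess ξ P)
    (hdrift : ∀ᵐ ω ∂P, Tendsto (fun t => ξ t ω) atTop atTop)
    (hη : IsIndepDual ξ η P) :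
    -- the integrals that define the objects converge, and the process is positive
    (∀ᵐ ω ∂P, IntegrableOn (fun s : ℝ => Real.exp (η s.toNNReal ω)) (Ioi 0)) ∧
    (∀ᵐ ω ∂P, ∀ t : ℝ, IntegrableOn (fun s : ℝ => Real.exp (twoSided ξ η s ω)) (Iic t) ∧
      0 < twoSidedGOU ξ η t ω) ∧
    -- (i)
    IsStationaryProcess (twoSidedGOU ξ η) P ∧
    IsStronglyMixing (twoSidedGOU ξ η) P ∧
    (∃ κ : ℝ≥0 → Kernel ℝ ℝ,
      (∀ t x, κ t x = P.map (gouFrom ξ x t)) ∧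
      (∀ t x, 0 < x → κ t x (Iic 0) = 0) ∧
      (∀ t x, 0 ≤ x → κ t x (Iio 0) = 0) ∧
      IsFellerProcess κ (twoSidedGOU ξ η) P) ∧
    (∀ t : ℝ, P.map (twoSidedGOU ξ η t) = P.map (expFunctional η)) ∧
    -- (ii)
    (∀ f : ℝ → ℝ, Integrable f (P.map (expFunctional η)) →
      ∀ᵐ ω ∂P,
        (∀ t : ℝ, IntervalIntegrable (fun s => f (twoSidedGOU ξ η s ω)) volume 0 t) ∧
        Tendsto (fun t : ℝ => t⁻¹ * ∫ s in (0 : ℝ)..t, f (twoSidedGOU ξ η s ω)) atTop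
          (𝓝 (∫ x, f x ∂(P.map (expFunctional η))))) := by
  have hY := isTwoSidedLevy_twoSided hξ hη
  have hi := ae_integrableOn_exp_twoSided hξ hdrift hη
  have hX := twoSidedGOU_eq_gouPath hξ hη
  have hlaw0 : P.map (twoSidedGOU ξ η 0) = P.map (expFunctional η) := by
    refine Measure.map_congr ?_
    filter_upwards [hξ.zero, ae_integral_exp_twoSided hξ hη] with ω h0 h1
    rw [twoSidedGOU, h1, twoSided_of_nonneg _ _ le_rfl, Real.toNNReal_zero, h0, neg_zero,
      Real.exp_zero, one_mul]
  have hlaw : ∀ t, P.map (twoSidedGOU ξ η t) = P.map (expFunctional η) := fun t => by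
    rw [← hlaw0, hX]
    exact hY.map_gouPath t
  refine ⟨ae_integrableOn_exp_dual hξ hdrift hη, ?_, ?_, ?_, ?_, hlaw, ?_⟩
  · filter_upwards [hi] with ω hω t
    refine ⟨hω t, mul_pos (Real.exp_pos _) ?_⟩
    -- Strict positivity of the integral needs a nonzero measure.
    have : NeZero (volume.restrict (Iic t)) := ⟨by simp [Measure.restrict_eq_zero]⟩
    exact integral_exp_pos (hω t)
  · rw [hX]
    exact hY.isStationaryProcess_gouPath
  · rw [hX]
    exact hY.isStronglyMixing_gouPath
  · have hκ : ∀ (t : ℝ≥0) x, gouKernel (P.map fun ω s => twoSided ξ η s ω) t x =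
        P.map fun ω => gouFlow x t fun s => twoSided ξ η s ω := fun t x =>
      gouKernel_map_apply hY.measurable t x
    have hm : ∀ (t : ℝ≥0) x, Measurable fun ω => gouFlow x t fun s => twoSided ξ η s ω :=
      fun t x => (measurable_gouFlow_right x t).comp hY.measurable
    refine ⟨gouKernel (P.map fun ω s => twoSided ξ η s ω), fun t x => ?_, fun t x hx => ?_,
      fun t x hx => ?_, hY.isFellerSemigroup_gouKernel, ?_, ?_⟩
    · rw [hκ, gouFlow_twoSided hξ hη]
    · rw [hκ, Measure.map_apply (hm t x) measurableSet_Iic]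
      convert measure_empty (μ := P)
      ext ω
      simpa using gouFlow_pos _ t.coe_nonneg hx
    · rw [hκ, Measure.map_apply (hm t x) measurableSet_Iio]
      convert measure_empty (μ := P)
      ext ω
      simpa using gouFlow_nonneg _ t.coe_nonneg hx
    · rw [hX]
      exact hY.isMarkovProcess_gouPath hi
    · rw [hX]
      exact hY.ae_isCadlag_gouPath hi
  · intro f hf
    have e : P.map (expFunctional η) = P.map fun ω => gouPath (fun s => twoSided ξ η s ω) 0 := by
      rw [← hlaw0, hX]
    rw [e] at hf ⊢
    rw [hX]
    exact hY.ae_tendsto_average hf
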